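/- For $\mathbf r=(r_0,r_1)\in\mathbb R^2$ let $\tau_{\mathbf r}:\mathbb Z^2\to\mathbb Z^2$, $\tau_{\mathbf r}(a_0,a_1)=(a_1,-\lfloor r_0a_0+r_1a_1\rfloor)$, and identify the orbit of $\mathbf a\in\mathbb Z^2$ with the integer sequence $(a_n)_{n\ge 0}$ given by $\tau_{\mathbf r}^n(\mathbf a)=(a_n,a_{n+1})$. Let $\mathcal D_2^{(*)}$ be the set of all $\mathbf r\in\mathbb R^2$ such that every ultimately periodic orbit of $\tau_{\mathbf r}$ is eventually zero, i.e. such that $\tau_{\mathbf r}$ has no nontrivial cycle. Let $\mathcal E_2$ be the set of all $\mathbf r\in\mathbb R^2$ such that all complex roots of $x^2+r_1x+r_0$ have absolute value less than $1$. Let $\mathcal O$ (the regions with obvious cycles) be the union of the four sets $$\{-2<r_0+r_1<0\},\quad \{r_1=r_0+1\},\quad \{-2<r_0\le -1,\ -1<r_1\le 0\},\quad \{-1\le r_0<0,\ 0\le r_1<1\}.$$ Let $\mathcal R\subseteq\mathbb R^2$ be the set of all points that lie neither in $\mathcal O$ nor in any of the following sets: 1. $\{r_0>0,\ r_1\le -2\sqrt{r_0},\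 r_0+r_1\ge 0\}$; 2. $\{r_0+r_1\le -2,\ r_0-r_1\ne -1\}\setminus\{r_0>-2,\ r_1>-1\}$; 3. $\{r_0+r_1\ge 0,\ r_0<0,\ r_1\ge 1\}$; 4. $\{r_0-r_1<-1,\ r_0\ge 0\}$; 5. $\{r_0-r_1>-\tfrac12,\ r_1\ge\max\{-2\sqrt{r_0},-r_0\},\ r_0>\tfrac32+\sqrt2\}$; 6. $\{-1<r_0-r_1\le -\tfrac12,\ r_1\ge 1+\sqrt5,\ r_1^2\ge 4r_0\}$. Then the following hold. (a) $\mathcal R$ is bounded. (b) Every $\mathbf r\in\mathcal R$ with $r_0\ge \tfrac43$ belongs to $\mathcal D_2^{(*)}$. (c) Outside $\mathcal E_2$, only the region $1\le r_0<\tfrac43$, $-r_0\le r_1<r_0+1$ remains undecided: every $\mathbf r\in\mathbb R^2\setminus\mathcal E_2$ that does not lie in this region satisfies $\mathbf r\in\mathcal D_2^{(*)}$ if and only if $\mathbf r\notin\mathcal O$. -/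

import Mathlib

namespace SRS

/-- The two-dimensional shift radix system `τ_r : ℤ² → ℤ²` with parameter `r = (r₀, r₁)`,
`(a₀, a₁) ↦ (a₁, -⌊r₀ a₀ + r₁ a₁⌋)`. -/
noncomputable def tau (r : ℝ × ℝ) (a : ℤ × ℤ) : ℤ × ℤ :=
  (a.2, -⌊r.1 * (a.1 : ℝ) + r.2 * (a.2 : ℝ)⌋)

/-- The orbit of `a` under `τ_r`, identified with the sequence of integers `(a_n)` that satisfies
`τ_rⁿ(a) = (a_n, a_{n+1})`. -/
noncomputable def orbit (r : ℝ × ℝ) (a : ℤ × ℤ) (n : ℕ) : ℤ :=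
  ((tau r)^[n] a).1

/-- A sequence of integers is ultimately periodic. -/
def UltimatelyPeriodic (u : ℕ → ℤ) : Prop :=
  ∃ n₀ p : ℕ, 0 < p ∧ ∀ n, n₀ ≤ n → u (n + p) = u n

/-- A sequence of integers ends up in the trivial cycle `(0)`. -/
def EndsInTrivialCycle (u : ℕ → ℤ) : Prop :=
  ∃ n₀ : ℕ, ∀ n, n₀ ≤ n → u n = 0

/-- The set `𝒟₂^(*)` of those `r` for which each ultimately periodic orbit of `τ_r` ends up in the
trivial cycle. -/
def DStar : Set (ℝ × ℝ) :=
  {r | ∀ a : ℤ × ℤ, UltimatelyPeriodic (orbit r a) → EndsInTrivialCycle (orbit r a)}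

/-- The Schur-Cohn region `ℰ₂` of contractive parameters. -/
def schurCohn : Set (ℝ × ℝ) :=
  {r | ∀ z : ℂ, z ^ 2 + (r.2 : ℂ) * z + (r.1 : ℂ) = 0 → ‖z‖ < 1}

/-- The regions of parameters with one of the cycles `(1)`, `(-1)`, `(t, -t)`, `(0, -1)`,
`(0, 1)`. -/
def obviousCycles : Set (ℝ × ℝ) :=
  {r | -2 < r.1 + r.2 ∧ r.1 + r.2 < 0} ∪
  {r | r.2 = r.1 + 1} ∪
  {r | (-2 < r.1 ∧ r.1 ≤ -1) ∧ (-1 < r.2 ∧ r.2 ≤ 0)} ∪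
  {r | (-1 ≤ r.1 ∧ r.1 < 0) ∧ (0 ≤ r.2 ∧ r.2 < 1)}

/-- The three regions in which the roots of `x² + r₁ x + r₀` are real and orbits are monotone. -/
def simpleOrbits : Set (ℝ × ℝ) :=
  {r | 0 < r.1 ∧ r.2 ≤ -2 * √r.1 ∧ 0 ≤ r.1 + r.2} ∪
  ({r | r.1 + r.2 ≤ -2 ∧ r.1 - r.2 ≠ -1} \ {r | -2 < r.1 ∧ -1 < r.2}) ∪
  {r | 0 ≤ r.1 + r.2 ∧ r.1 < 0 ∧ 1 ≤ r.2}

/-- The region `r₀ - r₁ < -1`, `r₀ ≥ 0`. -/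
def notSoSimpleOrbits : Set (ℝ × ℝ) :=
  {r | r.1 - r.2 < -1 ∧ 0 ≤ r.1}

/-- The unbounded region settled by the size estimate for elements of a cycle. -/
def largeParameters : Set (ℝ × ℝ) :=
  {r | -(1 / 2) < r.1 - r.2 ∧ max (-2 * √r.1) (-r.1) ≤ r.2 ∧ 3 / 2 + √2 < r.1}

/-- The unbounded part of the strip `-1 < r₀ - r₁ ≤ -1/2` over the parabola `r₁² = 4 r₀`. -/
def stripOverParabola : Set (ℝ × ℝ) :=
  {r | (-1 < r.1 - r.2 ∧ r.1 - r.2 ≤ -(1 / 2)) ∧ 1 + √5 ≤ r.2 ∧ 4 * r.1 ≤ r.2 ^ 2}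

/-- The region `ℛ` of parameters that lie in none of the regions above. -/
def unsettled : Set (ℝ × ℝ) :=
  (obviousCycles ∪ simpleOrbits ∪ notSoSimpleOrbits ∪ largeParameters ∪ stripOverParabola)ᶜ

/-- The bounded region of non-contractive parameters that is not decided. -/
def remaining : Set (ℝ × ℝ) :=
  {r | (1 ≤ r.1 ∧ r.1 < 4 / 3) ∧ (-r.1 ≤ r.2 ∧ r.2 < r.1 + 1)}

end SRS

/-!
A cycle of `τ_(x, y)` is a periodic sequence of integers `a` whose rounding errors
`bₙ = x aₙ + y aₙ₊₁ + aₙ₊₂` all lie in `[0, 1)`. The theorem amounts to the statement that `a = 0`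
whenever `(x, y)` has none of the obvious cycles and does not satisfy `0 ≤ x < 4 / 3`,
`-x ≤ y < x + 1`.

If `x + y ≤ -2`, if `x < 0`, or if `y > x + 1`, then the linear recurrence is so expansive that the
sign patterns and the growth of moduli can be read off from it, and a nonzero `a` could not be
periodic (`IsCycle.eq_zero_of_add_le`, `IsCycle.eq_zero_of_neg_fst`, `IsCycle.eq_zero_of_lt_snd`).

What is left is `x ≥ 4 / 3`, `-x ≤ y < x + 1`. Its unbounded part is settled by an energy argument:
for `σ = ±1` and `sₙ = aₙ₊₁ + σ aₙ`, the sum of `σ bₙ sₙ` over a period is at least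
`(x + σ y - 3) / 2` times the sum of `sₙ²`, whereas `σ bₙ sₙ ≤ sₙ²`, strictly unless `sₙ = 0`,
because `sₙ` is an integer. So `s = 0` if `x + σ y ≥ 5` (`IsCycle.add_mul_eq_zero`).

In the pentagon that remains, put `w = y - 1`, `d = 1 + x - y`, `sₙ = aₙ + aₙ₊₁`, so that
`bₙ = sₙ₊₁ + w sₙ + d aₙ` and `d aₙ₊₁ = d sₙ - d aₙ`, and start at a term `a₀` of maximal modulus
`M`. Once the values of `s₀, …, sₙ` are chosen, all conditions are linear in `w` and `d` for a given
`M`, and linear in `w`, `d` and `e = d M` if `M` is unknown. The orbit spirals outwards, hence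
exceeds the bound `M` after a few steps, and the tree of possible values of `s₀, s₁, …` is finite;
each branch ends with a contradictory system of linear inequalities, which is certified by a
nonnegative combination of them (`SearchTree.check`, `IsCycle.false_of_check`). One such search is
made for each `M ≤ 5` and each sign of `a₀`. For `M ≥ 6` all sizes are treated at once; this needs a
bound for `e`, and `d M ≤ 2` follows from two estimates that compare the recurrence with its
diagonalization (`mul_sq_le_of_sq_lt`) and with a real approximation of it near the parabola
`y² = 4 x` (`mul_le_of_two_lt`), see `IsCycle.two_le_and_mul_le`.
-/

namespace SRS

/-! ### Cycles -/

/-- `a` is the sequence of a cycle of `τ_(x, y)`, extended periodically with period `p`. -/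
structure IsCycle (x y : ℝ) (p : ℕ) (a : ℕ → ℤ) : Prop where
  pos : 0 < p
  periodic : Function.Periodic a p
  nonneg : ∀ n, 0 ≤ x * a n + y * a (n + 1) + a (n + 2)
  lt_one : ∀ n, x * a n + y * a (n + 1) + a (n + 2) < 1

/-- A real-valued function on `ℕ` with a positive period attains its maximum, and does so at a
positive argument. -/
lemma exists_forall_le_of_periodic {f : ℕ → ℝ} {p : ℕ} (hp : 0 < p)
    (hf : Function.Periodic f p) : ∃ N, ∀ n, f n ≤ f (N + 1) := by
  obtain ⟨m, -, hm⟩ := Finset.exists_max_image (Finset.range p) f ⟨0, by simpa using hp⟩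
  refine ⟨m + p - 1, fun n => ?_⟩
  rw [Nat.sub_add_cancel (by omega), hf m, ← hf.map_mod_nat n]
  exact hm _ (Finset.mem_range.2 (Nat.mod_lt _ hp))

/-- A periodic sequence of integers cannot increase forever along an arithmetic progression with
difference `k`; `P` is an invariant that keeps the increase going. -/
lemma false_of_periodic_of_lt {f : ℕ → ℤ} {p : ℕ} (hp : 0 < p) (hf : Function.Periodic f p)
    (k : ℕ) {P : ℕ → Prop} (hP : ∀ n, P n → P (n + k) ∧ f n < f (n + k)) {n : ℕ} (hn : P n) :
    False := by
  have key : ∀ i, P (n + i * k) ∧ f n + i ≤ f (n + i * k) := by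
    intro i
    induction i with
    | zero => simpa using hn
    | succ i ih =>
      have h := hP _ ih.1
      rw [show n + i * k + k = n + (i + 1) * k by ring] at h
      refine ⟨h.1, ?_⟩
      have := ih.2
      push_cast
      omega
  have h := (key p).2
  have e : f (n + k * p) = f n := by simpa using hf.nat_mul k n
  rw [mul_comm, e] at h
  omega

/-- A property of the terms of a periodic sequence that passes from each term to the preceding one
holds for all terms or for none. -/
lemma forall_of_periodic_of_succ {f : ℕ → ℤ} {p : ℕ} (hp : 0 < p) (hf : Function.Periodic f p)
    {P : ℤ → Prop} (hP : ∀ n, P (f (n + 1)) → P (f n)) {n : ℕ} (hn : P (f n)) (m : ℕ) :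
    P (f m) := by
  have key : ∀ i j, P (f (j + i)) → P (f j) := by
    intro i
    induction i with
    | zero => exact fun j h => h
    | succ i ih => exact fun j h => ih j (hP _ h)
  refine key (n + m * p - m) m ?_
  have : m ≤ m * p := Nat.le_mul_of_pos_right m hp
  rw [show m + (n + m * p - m) = n + m * p by omega]
  have e : f (n + m * p) = f n := by simpa using hf.nat_mul m n
  rwa [e]

namespace IsCycle

variable {x y : ℝ} {p : ℕ} {a : ℕ → ℤ}

lemma exists_forall_abs_le (h : IsCycle x y p a) : ∃ N, ∀ n, |a n| ≤ |a (N + 1)| := by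
  obtain ⟨N, hN⟩ := exists_forall_le_of_periodic (f := fun n => |(a n : ℝ)|) h.pos
    (fun n => by simp only [h.periodic n])
  exact ⟨N, fun n => by exact_mod_cast hN n⟩

/-- A cycle that is not zero everywhere has a nonzero term of maximal modulus, at a positive
index. -/
lemma eq_zero_of_max (h : IsCycle x y p a)
    (H : ∀ N, (∀ n, |a n| ≤ |a (N + 1)|) → a (N + 1) ≠ 0 → False) (n : ℕ) : a n = 0 := by
  obtain ⟨N, hN⟩ := h.exists_forall_abs_le
  by_contra hn
  refine H N hN fun h0 => hn ?_
  simpa [h0] using hN n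

lemma eq_zero_of_consecutive (h : IsCycle x y p a) {n : ℕ} (h0 : a n = 0) (h1 : a (n + 1) = 0)
    (m : ℕ) : a m = 0 := by
  have key : ∀ i, a (n + i) = 0 ∧ a (n + i + 1) = 0 := by
    intro i
    induction i with
    | zero => exact ⟨h0, h1⟩
    | succ i ih =>
      refine ⟨ih.2, ?_⟩
      have hl := h.nonneg (n + i)
      have hu := h.lt_one (n + i)
      rw [ih.1, ih.2] at hl hu
      norm_num at hl hu
      have : a (n + i + 2) < 1 := by exact_mod_cast hu
      have e : a (n + (i + 1) + 1) = a (n + i + 2) := by congr 1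
      omega
  have hle : n ≤ m + n * p := by
    have := Nat.le_mul_of_pos_right n h.pos
    omega
  have := (key (m + n * p - n)).1
  have e : a (m + n * p) = a m := by simpa using h.periodic.nat_mul n m
  rwa [Nat.add_sub_cancel' hle, e] at this

/-! ### Parameters with `r₀ + r₁ ≤ -2` -/

lemma eq_zero_of_add_le_of_nonneg_snd (h : IsCycle x y p a) (hxy : x + y ≤ -2) (hy : 0 ≤ y)
    (n : ℕ) : a n = 0 := by
  refine h.eq_zero_of_max (fun N hN h0 => ?_) n
  have h1 := hN (N + 2)
  have h3 := hN (N + 3)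
  have hl := h.nonneg (N + 1)
  have hu := h.lt_one (N + 1)
  simp only [add_assoc, Nat.reduceAdd] at hl hu
  rcases lt_or_gt_of_ne h0 with hneg | hpos
  · rw [abs_of_neg hneg, abs_le] at h1 h3
    have a1 : (a (N + 2) : ℝ) ≥ a (N + 1) := by exact_mod_cast (by omega)
    have a2 : (a (N + 1) : ℝ) ≤ -1 := by exact_mod_cast (by omega)
    have : (a (N + 3) : ℝ) < a (N + 1) := by nlinarith
    have : a (N + 3) < a (N + 1) := by exact_mod_cast this
    omega
  · rw [abs_of_pos hpos, abs_le] at h1 h3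
    have a1 : (a (N + 2) : ℝ) ≤ a (N + 1) := by exact_mod_cast h1.2
    have a2 : (1 : ℝ) ≤ a (N + 1) := by exact_mod_cast hpos
    have : (a (N + 1) : ℝ) < a (N + 3) := by nlinarith
    have : a (N + 1) < a (N + 3) := by exact_mod_cast this
    omega

lemma eq_zero_of_add_le_of_nonneg_fst (h : IsCycle x y p a) (hxy : x + y ≤ -2) (hx : 0 ≤ x)
    (n : ℕ) : a n = 0 := by
  refine h.eq_zero_of_max (fun N hN h0 => ?_) n
  have h1 := hN N
  have h3 := hN (N + 2)
  have hl := h.nonneg N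
  have hu := h.lt_one N
  rcases lt_or_gt_of_ne h0 with hneg | hpos
  · rw [abs_of_neg hneg, abs_le] at h1 h3
    have a1 : (a N : ℝ) ≥ a (N + 1) := by exact_mod_cast (by omega)
    have a2 : (a (N + 1) : ℝ) ≤ -1 := by exact_mod_cast (by omega)
    have : (a (N + 2) : ℝ) < a (N + 1) := by nlinarith
    have : a (N + 2) < a (N + 1) := by exact_mod_cast this
    omega
  · rw [abs_of_pos hpos, abs_le] at h1 h3
    have a1 : (a N : ℝ) ≤ a (N + 1) := by exact_mod_cast h1.2
    have a2 : (1 : ℝ) ≤ a (N + 1) := by exact_mod_cast hpos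
    have : (a (N + 1) : ℝ) < a (N + 2) := by nlinarith
    have : a (N + 1) < a (N + 2) := by exact_mod_cast this
    omega

lemma eq_zero_of_le_neg_two (h : IsCycle x y p a) (hx : x ≤ -2) (hy : y < 0) (hxy : x + 1 < y)
    (n : ℕ) : a n = 0 := by
  refine h.eq_zero_of_max (fun N hN h0 => ?_) n
  set M := |a (N + 1)| with hM
  have hM0 : 1 ≤ M := Int.one_le_abs h0
  have hMR : (1 : ℝ) ≤ M := by exact_mod_cast hM0
  have hlow (n : ℕ) : (-M : ℝ) ≤ a n := by exact_mod_cast (abs_le.1 (hN n)).1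
  -- a term equal to `M` would be followed by a larger one, so the maximal modulus is attained at
  -- negative terms only
  have hup (n : ℕ) : (a n : ℝ) ≤ M - 1 := by
    have hne : a n ≠ M := by
      intro e
      have hl := h.nonneg n
      rw [e] at hl
      have h1 := hlow (n + 1)
      have : (M : ℝ) < a (n + 2) := by nlinarith
      have : M < a (n + 2) := by exact_mod_cast this
      have := (abs_le.1 (hN (n + 2))).2
      omega
    have := (abs_le.1 (hN n)).2
    exact_mod_cast (by omega : a n ≤ M - 1)
  have hneg : a (N + 1) = -M := by
    have := hup (N + 1)
    have : a (N + 1) ≤ M - 1 := by exact_mod_cast this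
    rcases abs_choice (a (N + 1)) with e | e <;> omega
  have hu := h.lt_one (N + 1)
  simp only [add_assoc, Nat.reduceAdd] at hu
  rw [hneg] at hu
  push_cast at hu
  have h2 := hup (N + 2)
  have h3 := hlow (N + 3)
  have hmul : y * (M - 1) ≤ y * a (N + 2) := mul_le_mul_of_nonpos_left h2 hy.le
  rcases le_or_gt y (-1) with hy1 | hy1
  · nlinarith
  · nlinarith

section Alternating

variable (hx : x < 0) (hy : y ≤ -1) (hxy : x + y ≤ -2)
include hx hy

lemma not_pos_pos (h : IsCycle x y p a) (n : ℕ) : ¬ (1 ≤ a n ∧ 1 ≤ a (n + 1)) := by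
  intro hn
  refine false_of_periodic_of_lt (f := fun n => a (n + 1)) h.pos
    (fun n => by simpa [add_right_comm] using h.periodic (n + 1)) 1
    (P := fun n => 1 ≤ a n ∧ 1 ≤ a (n + 1)) (fun m hm => ?_) hn
  have hl := h.nonneg m
  have h1 : (1 : ℝ) ≤ a m := by exact_mod_cast hm.1
  have h2 : (1 : ℝ) ≤ a (m + 1) := by exact_mod_cast hm.2
  have : (a (m + 1) : ℝ) < a (m + 2) := by nlinarith
  have : a (m + 1) < a (m + 2) := by exact_mod_cast this
  exact ⟨⟨hm.2, by simp only [add_assoc, Nat.reduceAdd]; omega⟩, this⟩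

include hxy

lemma not_neg_neg (h : IsCycle x y p a) (n : ℕ) : ¬ (a n ≤ -1 ∧ a (n + 1) ≤ -1) := by
  intro hn
  refine false_of_periodic_of_lt (f := fun n => -a (n + 1)) h.pos
    (fun n => by simpa [add_right_comm] using h.periodic (n + 1)) 1
    (P := fun n => a n ≤ -1 ∧ a (n + 1) ≤ -1) (fun m hm => ?_) hn
  have hl := h.lt_one m
  have h1 : (a m : ℝ) ≤ -1 := by exact_mod_cast hm.1
  have h2 : (a (m + 1) : ℝ) ≤ -1 := by exact_mod_cast hm.2
  have : (a (m + 2) : ℝ) < a (m + 1) := by nlinarith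
  have : a (m + 2) < a (m + 1) := by exact_mod_cast this
  exact ⟨⟨hm.2, by simp only [add_assoc, Nat.reduceAdd]; omega⟩, by simpa using this⟩

lemma not_zero_nonzero (h : IsCycle x y p a) (n : ℕ) (h0 : a n = 0) : a (n + 1) = 0 := by
  have hl := h.nonneg n
  have hu := h.lt_one n
  rw [h0] at hl hu
  norm_num at hl hu
  rcases lt_trichotomy (a (n + 1)) 0 with h1 | h1 | h1
  · refine (h.not_neg_neg hx hy hxy (n + 1) ⟨by omega, ?_⟩).elim
    have : (a (n + 1) : ℝ) ≤ -1 := by exact_mod_cast (by omega)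
    have : (a (n + 2) : ℝ) < 0 := by nlinarith
    have : a (n + 2) < 0 := by exact_mod_cast this
    simp only [add_assoc, Nat.reduceAdd]
    omega
  · exact h1
  · refine (h.not_pos_pos hx hy (n + 1) ⟨by omega, ?_⟩).elim
    have : (1 : ℝ) ≤ a (n + 1) := by exact_mod_cast (by omega)
    have : (0 : ℝ) < a (n + 2) := by nlinarith
    have : 0 < a (n + 2) := by exact_mod_cast this
    simp only [add_assoc, Nat.reduceAdd]
    omega

/-- The case in which the roots of `t² + y t + x` lie in `(-1, 0)` and `(1, ∞)`: the signs of a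
cycle would alternate, and its positive terms would decrease. -/
lemma eq_zero_of_alternating (h : IsCycle x y p a) (hd : y < x + 1) (m : ℕ) : a m = 0 := by
  by_contra hm
  have hne (n : ℕ) : a n ≠ 0 := fun h0 =>
    hm (h.eq_zero_of_consecutive h0 (h.not_zero_nonzero hx hy hxy n h0) m)
  have hpos (n : ℕ) (hn : a n ≤ -1) : 1 ≤ a (n + 1) := by
    have := h.not_neg_neg hx hy hxy n
    have := hne (n + 1)
    omega
  have hneg (n : ℕ) (hn : 1 ≤ a n) : a (n + 1) ≤ -1 := by
    have := h.not_pos_pos hx hy n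
    have := hne (n + 1)
    omega
  -- a negative term that is outweighed by its successor starts a growing subsequence of sums
  have hsum (n : ℕ) (hn : a n ≤ -1) : a n + a (n + 1) ≤ -1 := by
    by_contra hcon
    refine false_of_periodic_of_lt (f := fun n => a n + a (n + 1)) h.pos
      (fun n => by simp only [add_right_comm n p 1, h.periodic n, h.periodic (n + 1)]) 2
      (P := fun n => a n ≤ -1 ∧ 0 ≤ a n + a (n + 1)) (fun k hk => ?_) ⟨hn, by omega⟩
    have e2 := hneg _ (hpos k hk.1)
    have hl := h.nonneg k
    have hl' := h.nonneg (k + 1)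
    simp only [add_assoc, Nat.reduceAdd] at hl' e2 ⊢
    have h1 : (a k : ℝ) ≤ -1 := by exact_mod_cast hk.1
    have h2 : (0 : ℝ) ≤ a k + a (k + 1) := by exact_mod_cast hk.2
    set s : ℝ := a k + a (k + 1) with hs
    set s' : ℝ := a (k + 1) + a (k + 2) with hs'
    have b1 : (1 - y) * s + (1 + x - y) * (-a k) ≤ s' := by
      rw [hs, hs']; linarith
    have b2 : (1 - y) * s' - (1 + x - y) * a (k + 1) ≤ a (k + 2) + a (k + 3) := by
      rw [hs']; linarith
    have e1 : (a (k + 1) : ℝ) = s - a k := by rw [hs]; ring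
    have b3 : (1 - y) * ((1 - y) * s + (1 + x - y) * (-a k)) ≤ (1 - y) * s' :=
      mul_le_mul_of_nonneg_left b1 (by linarith)
    have b4 : s < a (k + 2) + a (k + 3) := by
      have : 0 < (1 + x - y) * (-a k) := mul_pos (by linarith) (by linarith)
      have c1 : 0 < (-y) * ((1 + x - y) * (-a k)) := mul_pos (by linarith) this
      have c2 : 0 ≤ s * ((1 - y) * (1 - y) - (1 + x - y) - 1) := by
        refine mul_nonneg h2 ?_
        nlinarith
      rw [e1] at b2
      nlinarith
    rw [hs] at b4
    have b5 : a k + a (k + 1) < a (k + 2) + a (k + 3) := by exact_mod_cast b4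
    exact ⟨⟨e2, by omega⟩, b5⟩
  obtain ⟨n, hn⟩ : ∃ n, 1 ≤ a n := by
    have := hne 0
    rcases lt_or_ge (a 0) 0 with h0 | h0
    · exact ⟨1, hpos 0 (by omega)⟩
    · exact ⟨0, by omega⟩
  refine false_of_periodic_of_lt (f := fun n => -a n) h.pos
    (fun n => by simp only [h.periodic n]) 2 (P := fun n => 1 ≤ a n) (fun k hk => ?_) hn
  have e1 := hneg k hk
  have e2 := hpos _ e1
  have e3 := hsum _ e1
  have hu := h.lt_one k
  simp only [add_assoc, Nat.reduceAdd] at e2 e3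
  refine ⟨e2, ?_⟩
  have h0 : (1 : ℝ) ≤ a k := by exact_mod_cast hk
  have h2 : (a (k + 1) : ℝ) + a (k + 2) ≤ -1 := by exact_mod_cast e3
  have h3 : (1 : ℝ) ≤ a (k + 2) := by exact_mod_cast e2
  have : (a (k + 2) : ℝ) < a k := by
    by_contra hge
    push Not at hge
    have c1 : -y * (a (k + 2) + 1) ≤ -y * (-a (k + 1)) :=
      mul_le_mul_of_nonneg_left (by linarith) (by linarith)
    have c2 : (-x) * a k ≤ -x * a (k + 2) := mul_le_mul_of_nonneg_left hge (by linarith)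
    have c3 : 0 < (1 + x - y) * a (k + 2) := mul_pos (by linarith) (by linarith)
    nlinarith
  have : a (k + 2) < a k := by exact_mod_cast this
  simpa using this

end Alternating

lemma eq_zero_of_add_le (h : IsCycle x y p a) (hxy : x + y ≤ -2) (hne : y ≠ x + 1)
    (hO : ¬ (-2 < x ∧ -1 < y)) (n : ℕ) : a n = 0 := by
  rcases le_or_gt 0 y with hy | hy
  · exact h.eq_zero_of_add_le_of_nonneg_snd hxy hy n
  rcases le_or_gt 0 x with hx | hx
  · exact h.eq_zero_of_add_le_of_nonneg_fst hxy hx n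
  rcases lt_or_gt_of_ne hne with hd | hd
  · refine h.eq_zero_of_alternating hx ?_ hxy hd n
    by_contra hcon
    push Not at hcon
    exact hO ⟨by linarith, hcon⟩
  · have hx2 : x ≤ -2 := by
      by_contra hcon
      push Not at hcon
      exact hO ⟨hcon, by linarith⟩
    exact h.eq_zero_of_le_neg_two hx2 hy hd n

/-! ### Parameters with `r₀ < 0`, `r₁ ≥ 1` and `r₀ + r₁ ≥ 0` -/

section SignChange

variable (hx : x < 0) (hy : 1 ≤ y)
include hx hy

lemma not_nonneg_neg (h : IsCycle x y p a) (n : ℕ) : ¬ (0 ≤ a n ∧ a (n + 1) ≤ -1) := by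
  have hdown (m : ℕ) (h1 : a m ≤ 0) (h2 : 1 ≤ a (m + 1)) : a (m + 2) ≤ -a (m + 1) := by
    have hu := h.lt_one m
    have h1 : (a m : ℝ) ≤ 0 := by exact_mod_cast h1
    have h2 : (1 : ℝ) ≤ a (m + 1) := by exact_mod_cast h2
    have : (a (m + 2) : ℝ) < 1 - a (m + 1) := by nlinarith
    have : a (m + 2) < 1 - a (m + 1) := by exact_mod_cast this
    omega
  have hup (m : ℕ) (h1 : 0 ≤ a m) (h2 : a (m + 1) ≤ -1) : -a (m + 1) ≤ a (m + 2) := by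
    have hu := h.nonneg m
    have h1 : (0 : ℝ) ≤ a m := by exact_mod_cast h1
    have h2 : (a (m + 1) : ℝ) ≤ -1 := by exact_mod_cast h2
    have : (-a (m + 1) : ℝ) ≤ a (m + 2) := by nlinarith
    exact_mod_cast this
  have hstrict (m : ℕ) : ¬ (1 ≤ a m ∧ a (m + 1) ≤ -1) := by
    intro hm
    refine false_of_periodic_of_lt (f := fun n => -a (n + 1)) h.pos
      (fun n => by simpa [add_right_comm] using h.periodic (n + 1)) 2
      (P := fun n => 1 ≤ a n ∧ a (n + 1) ≤ -1) (fun k hk => ?_) hm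
    have hl := h.nonneg k
    have h1 : (1 : ℝ) ≤ a k := by exact_mod_cast hk.1
    have h2 : (a (k + 1) : ℝ) ≤ -1 := by exact_mod_cast hk.2
    have : (-a (k + 1) : ℝ) < a (k + 2) := by nlinarith
    have e1 : -a (k + 1) < a (k + 2) := by exact_mod_cast this
    have e2 := hdown (k + 1) (by omega) (by simp only [add_assoc, Nat.reduceAdd]; omega)
    simp only [add_assoc, Nat.reduceAdd] at e2 ⊢
    exact ⟨⟨by omega, by omega⟩, by omega⟩
  intro hn
  have e1 := hup n hn.1 hn.2
  have e2 := hdown (n + 1) (by omega) (by simp only [add_assoc, Nat.reduceAdd]; omega)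
  refine hstrict (n + 2) ?_
  simp only [add_assoc, Nat.reduceAdd] at e2 ⊢
  exact ⟨by omega, by omega⟩

lemma not_nonpos_pos (h : IsCycle x y p a) (n : ℕ) : ¬ (a n ≤ 0 ∧ 1 ≤ a (n + 1)) := by
  intro hn
  refine h.not_nonneg_neg hx hy (n + 1) ⟨by omega, ?_⟩
  have hu := h.lt_one n
  have h1 : (a n : ℝ) ≤ 0 := by exact_mod_cast hn.1
  have h2 : (1 : ℝ) ≤ a (n + 1) := by exact_mod_cast hn.2
  have : (a (n + 2) : ℝ) < 0 := by nlinarith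
  have : a (n + 2) < 0 := by exact_mod_cast this
  simp only [add_assoc, Nat.reduceAdd]
  omega

lemma eq_zero_of_neg_fst (h : IsCycle x y p a) (hxy : 0 ≤ x + y) (n : ℕ) : a n = 0 := by
  refine h.eq_zero_of_max (fun N hN h0 => ?_) n
  have hl := h.nonneg N
  have hu := h.lt_one N
  have hNN := hN N
  rcases lt_or_gt_of_ne h0 with hneg | hpos
  · have hall := forall_of_periodic_of_succ h.pos h.periodic (P := fun t => t ≤ -1)
      (fun n hn => by have := h.not_nonneg_neg hx hy n; omega) (n := N + 1) (by omega)
    have h2 : (a (N + 2) : ℝ) ≤ -1 := by exact_mod_cast hall (N + 2)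
    rw [abs_of_neg hneg, abs_le] at hNN
    have h3 : (a (N + 1) : ℝ) ≤ a N := by exact_mod_cast (by omega)
    have h4 : (a N : ℝ) ≤ -1 := by exact_mod_cast hall N
    nlinarith
  · have hall := forall_of_periodic_of_succ h.pos h.periodic (P := fun t => 1 ≤ t)
      (fun n hn => by have := h.not_nonpos_pos hx hy n; omega) (n := N + 1) (by omega)
    have h2 : (1 : ℝ) ≤ a (N + 2) := by exact_mod_cast hall (N + 2)
    rw [abs_of_pos hpos, abs_le] at hNN
    have h3 : (a N : ℝ) ≤ a (N + 1) := by exact_mod_cast hNN.2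
    have h4 : (1 : ℝ) ≤ a N := by exact_mod_cast hall N
    nlinarith

end SignChange

/-! ### Parameters with `r₀ ≥ 0` and `r₁ > r₀ + 1` -/

lemma eq_zero_of_lt_snd (h : IsCycle x y p a) (hx : 0 ≤ x) (hxy : x + 1 < y) (n : ℕ) :
    a n = 0 := by
  refine h.eq_zero_of_max (fun N hN h0 => ?_) n
  set M := |a (N + 1)| with hM
  have hM0 : 1 ≤ M := Int.one_le_abs h0
  have hMR : (1 : ℝ) ≤ M := by exact_mod_cast hM0
  have hlow (n : ℕ) : (-M : ℝ) ≤ a n := by exact_mod_cast (abs_le.1 (hN n)).1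
  have hup (n : ℕ) : (a n : ℝ) ≤ M := by exact_mod_cast (abs_le.1 (hN n)).2
  have hne (n : ℕ) : a (n + 1) ≠ -M := by
    intro e
    have hl := h.nonneg n
    rw [e] at hl
    push_cast at hl
    have h1 := hup n
    have h2 := hup (n + 2)
    nlinarith
  have e : a (N + 1) = M := by
    have := hne N
    rcases abs_choice (a (N + 1)) with e | e <;> omega
  have hu := h.lt_one N
  rw [e] at hu
  have h1 := hlow N
  have : (a (N + 2) : ℝ) < 1 - M := by nlinarith
  have : a (N + 2) < 1 - M := by exact_mod_cast this
  have := (abs_le.1 (hN (N + 2))).1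
  exact hne (N + 1) (by simp only [add_assoc, Nat.reduceAdd]; omega)

/-! ### An energy identity -/

lemma sum_sub_eq_zero (h : IsCycle x y p a) (G : ℤ → ℤ → ℝ) :
    ∑ n ∈ Finset.range p, (G (a n) (a (n + 1)) - G (a (n + 1)) (a (n + 2))) = 0 := by
  have := Finset.sum_range_sub' (fun n => G (a n) (a (n + 1))) p
  simp only [add_assoc, Nat.reduceAdd] at this
  rw [this]
  have e0 : a p = a 0 := by simpa using h.periodic 0
  have e1 : a (p + 1) = a 1 := by simpa [add_comm] using h.periodic 1
  simp [e0, e1]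

/-- With `s n = a (n + 1) + σ a n`, the products `σ bₙ sₙ` (where `bₙ ∈ [0, 1)` is the rounding
error) differ from `(x + σ y - 3) / 2 * sₙ ^ 2 + (sₙ₊₁ + σ sₙ) ^ 2 / 2` by a telescoping term,
while `σ bₙ sₙ ≤ sₙ ^ 2` because `sₙ` is an integer. If `x + σ y ≥ 5`, no `sₙ` differs from `0`. -/
lemma add_mul_eq_zero (h : IsCycle x y p a) {σ : ℤ} (hσ : σ = 1 ∨ σ = -1)
    (hxy : 5 ≤ x + σ * y) (n : ℕ) : a (n + 1) + σ * a n = 0 := by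
  have hσ2 : (σ : ℝ) * σ = 1 := by rcases hσ with rfl | rfl <;> norm_num
  set b : ℕ → ℝ := fun n => x * a n + y * a (n + 1) + a (n + 2) with hb
  set s : ℕ → ℤ := fun n => a (n + 1) + σ * a n with hs
  have hterm (n : ℕ) : 0 ≤ (s n : ℝ) ^ 2 - b n * (σ * s n) ∧
      ((s n : ℝ) ^ 2 - b n * (σ * s n) = 0 → s n = 0) := by
    have hl : 0 ≤ b n := h.nonneg n
    have hu : b n < 1 := h.lt_one n
    have e : (s n : ℝ) ^ 2 = (σ * s n) ^ 2 := by rw [mul_pow, sq (σ : ℝ), hσ2, one_mul]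
    rw [e]
    have hz : σ * s n = 0 → s n = 0 := by
      intro h0
      rcases hσ with rfl | rfl <;> omega
    rcases lt_trichotomy (σ * s n) 0 with h0 | h0 | h0
    · have h1 : (σ * s n : ℝ) ≤ -1 := by exact_mod_cast (by omega : σ * s n ≤ -1)
      have : 0 < (σ * s n : ℝ) ^ 2 - b n * (σ * s n) := by nlinarith
      exact ⟨this.le, fun h => absurd h this.ne'⟩
    · have h1 : (σ * s n : ℝ) = 0 := by exact_mod_cast h0
      exact ⟨by simp [h1], fun _ => hz h0⟩
    · have h1 : (1 : ℝ) ≤ σ * s n := by exact_mod_cast (by omega : 1 ≤ σ * s n)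
      have : 0 < (σ * s n : ℝ) ^ 2 - b n * (σ * s n) := by nlinarith
      exact ⟨this.le, fun h => absurd h this.ne'⟩
  set G : ℤ → ℤ → ℝ := fun u v => -((v + σ * u) ^ 2 : ℝ) / 2 - (1 + x - σ * y) / 2 * u ^ 2
    with hG
  have hid (n : ℕ) : (s n : ℝ) ^ 2 - b n * (σ * s n) ≤
      G (a n) (a (n + 1)) - G (a (n + 1)) (a (n + 2)) := by
    have e : b n * (σ * s n) = (x + σ * y - 3) / 2 * (s n) ^ 2
        + (s (n + 1) + σ * s n) ^ 2 / 2
        - (G (a n) (a (n + 1)) - G (a (n + 1)) (a (n + 2))) := by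
      simp only [hb, hs, hG, add_assoc, Nat.reduceAdd]
      push_cast
      rcases hσ with rfl | rfl <;> push_cast <;> ring
    have h1 : 0 ≤ (x + σ * y - 5) / 2 * (s n : ℝ) ^ 2 :=
      mul_nonneg (by linarith) (sq_nonneg _)
    have h2 := sq_nonneg ((s (n + 1) : ℝ) + σ * s n)
    linarith
  have hsum : ∑ n ∈ Finset.range p, ((s n : ℝ) ^ 2 - b n * (σ * s n)) = 0 := by
    refine le_antisymm ?_ (Finset.sum_nonneg fun n _ => (hterm n).1)
    exact (Finset.sum_le_sum fun n _ => hid n).trans_eq (h.sum_sub_eq_zero G)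
  rw [Finset.sum_eq_zero_iff_of_nonneg fun n _ => (hterm n).1] at hsum
  have hper : Function.Periodic s p := fun n => by
    simp only [hs, add_right_comm n p 1, h.periodic n, h.periodic (n + 1)]
  have := (hterm _).2 (hsum (n % p) (Finset.mem_range.2 (Nat.mod_lt n h.pos)))
  rwa [hper.map_mod_nat] at this

lemma eq_zero_of_five_le_add (h : IsCycle x y p a) (hxy : 5 ≤ x + y) (hne : y ≠ x + 1) (n : ℕ) :
    a n = 0 := by
  have hs := h.add_mul_eq_zero (σ := 1) (Or.inl rfl) (by simpa using hxy)
  have e (n : ℕ) : (a (n + 1) : ℝ) = -a n := by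
    have := hs n
    exact_mod_cast (by omega : a (n + 1) = -a n)
  have hl := h.nonneg n
  have hl' := h.nonneg (n + 1)
  simp only [e] at hl hl'
  have : (x + 1 - y) * (a n : ℝ) = 0 := by nlinarith
  rcases mul_eq_zero.1 this with h0 | h0
  · exact absurd (by linarith) hne
  · exact_mod_cast h0

lemma eq_zero_of_five_le_sub (h : IsCycle x y p a) (hxy : 5 ≤ x - y) (h0 : 0 ≤ x + y) (n : ℕ) :
    a n = 0 := by
  have hs := h.add_mul_eq_zero (σ := -1) (Or.inr rfl) (by push_cast; linarith)
  have e (n : ℕ) : (a (n + 1) : ℝ) = a n := by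
    have := hs n
    exact_mod_cast (by omega : a (n + 1) = a n)
  have hl := h.nonneg n
  have hu := h.lt_one n
  simp only [e] at hl hu
  rcases lt_trichotomy (a n) 0 with h1 | h1 | h1
  · have : (a n : ℝ) ≤ -1 := by exact_mod_cast (by omega : a n ≤ -1)
    nlinarith
  · exact h1
  · have : (1 : ℝ) ≤ a n := by exact_mod_cast h1
    nlinarith

end IsCycle

/-! ### A verified search -/

/-- The affine form `const + cw * w + cd * d + ce * e` with integer coefficients. -/
structure AffineForm where
  const : ℤ
  cw : ℤ
  cd : ℤ
  ce : ℤ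

namespace AffineForm

/-- The value of an affine form at the point `(w, d, e)`. -/
def eval (f : AffineForm) (w d e : ℝ) : ℝ := f.const + f.cw * w + f.cd * d + f.ce * e

def add (f g : AffineForm) : AffineForm :=
  ⟨f.const + g.const, f.cw + g.cw, f.cd + g.cd, f.ce + g.ce⟩

def smul (k : ℤ) (f : AffineForm) : AffineForm :=
  ⟨k * f.const, k * f.cw, k * f.cd, k * f.ce⟩

def neg (f : AffineForm) : AffineForm := ⟨-f.const, -f.cw, -f.cd, -f.ce⟩

variable (f g : AffineForm) (k : ℤ) (w d e : ℝ)

@[simp] lemma eval_mk (c i j l : ℤ) : eval ⟨c, i, j, l⟩ w d e = c + i * w + j * d + l * e := rfl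

@[simp] lemma eval_add : (f.add g).eval w d e = f.eval w d e + g.eval w d e := by
  simp only [eval, add]; push_cast; ring

@[simp] lemma eval_smul : (f.smul k).eval w d e = k * f.eval w d e := by
  simp only [eval, smul]; push_cast; ring

@[simp] lemma eval_neg : f.neg.eval w d e = -f.eval w d e := by
  simp only [eval, neg]; push_cast; ring

end AffineForm

/-- The constraint `form > 0` if `strict` is true, and `form ≥ 0` otherwise. -/
structure Constraint where
  strict : Bool
  form : AffineForm

/-- The point `(w, d, e)` satisfies the constraint. -/
def Constraint.Holds (c : Constraint) (w d e : ℝ) : Prop :=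
  0 ≤ c.form.eval w d e ∧ (c.strict = true → 0 < c.form.eval w d e)

/-- A combination of the members of a list of constraints: positions in the list, with
multipliers. Positions outside the list are ignored. -/
abbrev Combination := List (ℕ × ℕ)

/-- The affine form that a combination of constraints bounds from below by `0`. The boolean tells
whether a strict constraint takes part. -/
def combine (Γ : List Constraint) : Combination → Bool × AffineForm
  | [] => (false, ⟨0, 0, 0, 0⟩)
  | (i, m) :: l =>
    match Γ[i]?, combine Γ l with
    | none, r => r
    | some c, (st, f) => ((c.strict && Nat.blt 0 m) || st, (c.form.smul m).add f)

/-- The combination shows that no point satisfies all the constraints: it is a constant form that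
is negative, or zero with a strict constraint involved. -/
def refutes (Γ : List Constraint) (l : Combination) : Bool :=
  match combine Γ l with
  | (st, f) => f.cw == 0 && f.cd == 0 && f.ce == 0 && (decide (f.const < 0) || (st && f.const == 0))

lemma combine_nonneg {Γ : List Constraint} {w d e : ℝ} (hΓ : ∀ c ∈ Γ, c.Holds w d e)
    (l : Combination) : 0 ≤ (combine Γ l).2.eval w d e ∧
      ((combine Γ l).1 = true → 0 < (combine Γ l).2.eval w d e) := by
  induction l with
  | nil => simp [combine]
  | cons q l ih =>
    obtain ⟨i, m⟩ := q
    simp only [combine]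
    rcases hc : Γ[i]? with _ | c
    · exact ih
    · obtain ⟨h1, h2⟩ := hΓ c (List.mem_of_getElem? hc)
      have hm : (0 : ℝ) ≤ m := Nat.cast_nonneg m
      simp only [AffineForm.eval_add, AffineForm.eval_smul, Int.cast_natCast, Bool.or_eq_true,
        Bool.and_eq_true, Nat.blt_eq]
      refine ⟨add_nonneg (mul_nonneg hm h1) ih.1, ?_⟩
      rintro (⟨hs, hm0⟩ | hs)
      · exact add_pos_of_pos_of_nonneg (mul_pos (by exact_mod_cast hm0) (h2 hs)) ih.1
      · exact add_pos_of_nonneg_of_pos (mul_nonneg hm h1) (ih.2 hs)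

lemma false_of_refutes {Γ : List Constraint} {w d e : ℝ} (hΓ : ∀ c ∈ Γ, c.Holds w d e)
    {l : Combination} (hl : refutes Γ l = true) : False := by
  have h := combine_nonneg hΓ l
  simp only [refutes, Bool.and_eq_true, Bool.or_eq_true, beq_iff_eq, decide_eq_true_eq] at hl
  obtain ⟨⟨⟨h1, h2⟩, h3⟩, h4⟩ := hl
  simp only [AffineForm.eval, h1, h2, h3, Int.cast_zero, zero_mul, add_zero] at h
  rcases h4 with h4 | ⟨h4, h5⟩
  · have : ((combine Γ l).2.const : ℝ) < 0 := by exact_mod_cast h4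
    linarith
  · have := h.2 h4
    rw [h5] at this
    simp at this

/-- A search tree over the values of the integers `sₙ`. In `next k below t` the next value is at
least `k`, as `below` refutes smaller ones; `value t t'` says what happens if the next value is
equal to the current lower bound (in `t`) and if it is larger (in `t'`); `above l` refutes all
values from the current lower bound on; `contra l` refutes the constraints found so far. -/
inductive SearchTree where
  | contra (l : Combination)
  | next (k : ℤ) (below : Combination) (t : SearchTree)
  | value (t t' : SearchTree)
  | above (l : Combination)

/-- The constraints on `(w, d, e)` if `s` and `f` are the values of `sₙ` and `d * aₙ` and the next
value `sₙ₊₁` is equal to `k`; the values `d * aₙ` do not exceed `E` in modulus. The first constraint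
is the bound of `IsCycle.abs_sum_le` for `sₙ₊₁`, the next two are `|d * aₙ₊₂| ≤ E`, where
`d * aₙ₊₂ = d * aₙ + d * (k - s)`, and the last two say that the rounding error lies in `[0, 1)`. -/
def stepConstraints (E : AffineForm) (s : ℤ) (f : AffineForm) (k : ℤ) : List Constraint :=
  [⟨false, E.add ⟨1 + k.natAbs, -k.natAbs, 0, 0⟩⟩,
    ⟨false, E.add (f.add ⟨0, 0, k - s, 0⟩)⟩,
    ⟨false, E.add (f.add ⟨0, 0, k - s, 0⟩).neg⟩,
    ⟨true, (f.add ⟨k - 1, s, 0, 0⟩).neg⟩,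
    ⟨false, f.add ⟨k, s, 0, 0⟩⟩]

/-- The constraints that follow from `sₙ₊₁ ≤ k`. -/
def belowConstraints (E : AffineForm) (s : ℤ) (f : AffineForm) (k : ℤ) : List Constraint :=
  [⟨false, E.add (f.add ⟨0, 0, k - s, 0⟩)⟩, ⟨false, f.add ⟨k, s, 0, 0⟩⟩]

/-- The constraints that follow from `k ≤ sₙ₊₁`. -/
def aboveConstraints (E : AffineForm) (s : ℤ) (f : AffineForm) (k : ℤ) : List Constraint :=
  [⟨false, E.add (f.add ⟨0, 0, k - s, 0⟩).neg⟩, ⟨true, (f.add ⟨k - 1, s, 0, 0⟩).neg⟩]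

/-- The tree refutes the constraints `Γ`, with `s` and `f` the values of `sₙ` and `d * aₙ` and `lb`
a lower bound of `sₙ₊₁`. -/
def SearchTree.check (E : AffineForm) : SearchTree → List Constraint → ℤ → AffineForm →
    Option ℤ → Bool
  | contra l, Γ, _, _, _ => refutes Γ l
  | next k below t, Γ, s, f, _ =>
    refutes (belowConstraints E s f (k - 1) ++ Γ) below && t.check E Γ s f (some k)
  | value _ _, _, _, _, none => false
  | value t t', Γ, s, f, some k =>
    t.check E (stepConstraints E s f k ++ Γ) k (f.neg.add ⟨0, 0, s, 0⟩) none &&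
      t'.check E Γ s f (some (k + 1))
  | above _, _, _, _, none => false
  | above l, Γ, s, f, some k => refutes (aboveConstraints E s f k ++ Γ) l

/-- With `f` the value of `d * aₙ`, the trees in the list refute the constraints `Γ j`,
`Γ (j + 1)`, … for the values `τ * j`, `τ * (j + 1)`, … of `sₙ`. -/
def checkList (E f : AffineForm) (Γ : ℤ → List Constraint) (τ : ℤ) : ℤ → List SearchTree → Bool
  | _, [] => true
  | j, t :: l => t.check E (Γ j) (τ * j) f none && checkList E f Γ τ (j + 1) l

namespace IsCycle

variable {x y : ℝ} {p : ℕ} {a : ℕ → ℤ}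

/-- With `w = y - 1` and `d = 1 + x - y`, the sums `sₙ = aₙ + aₙ₊₁` satisfy
`sₙ₊₁ + w sₙ + d aₙ ∈ [0, 1)`. -/
lemma sum_recurrence (h : IsCycle x y p a) (n : ℕ) :
    0 ≤ ((a (n + 1) + a (n + 2) : ℤ) : ℝ) + (y - 1) * (a n + a (n + 1) : ℤ) + (1 + x - y) * a n ∧
    ((a (n + 1) + a (n + 2) : ℤ) : ℝ) + (y - 1) * (a n + a (n + 1) : ℤ) + (1 + x - y) * a n < 1
    := by
  have hl := h.nonneg n
  have hu := h.lt_one n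
  push_cast
  constructor <;> linarith

/-- Since `sₙ₊₁ = -w sₙ + O(1)`, the values `sₙ` of a cycle are bounded if `w > 1`. -/
lemma abs_sum_le (h : IsCycle x y p a) {B : ℝ} (hB : ∀ n, |(1 + x - y) * a n| ≤ B) (n : ℕ) :
    (y - 2) * |((a n + a (n + 1) : ℤ) : ℝ)| ≤ 1 + B := by
  obtain ⟨N, hN⟩ := exists_forall_le_of_periodic (f := fun n => |((a n + a (n + 1) : ℤ) : ℝ)|)
    h.pos (fun n => by simp only [add_right_comm n p 1, h.periodic n, h.periodic (n + 1)])
  have hn := hN n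
  have hN2 := hN (N + 2)
  simp only [add_assoc, Nat.reduceAdd] at hn hN2
  set S := |((a (N + 1) + a (N + 2) : ℤ) : ℝ)| with hS
  have hB0 : 0 ≤ B := (abs_nonneg _).trans (hB 0)
  rcases le_or_gt y 2 with hy | hy
  · have := mul_nonneg (by linarith : 0 ≤ 2 - y) (abs_nonneg ((a n + a (n + 1) : ℤ) : ℝ))
    linarith
  · have h1 := h.sum_recurrence (N + 1)
    simp only [add_assoc, Nat.reduceAdd] at h1
    have h2 := abs_le.1 (hB (N + 1))
    have h3 := abs_le.1 hN2
    have h4 : (y - 1) * S ≤ 1 + B + S := by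
      rw [hS, ← abs_of_pos (by linarith : 0 < y - 1), ← abs_mul, abs_le, ← hS]
      constructor <;> linarith
    have := mul_le_mul_of_nonneg_left hn (by linarith : 0 ≤ y - 2)
    linarith

variable {E : AffineForm} {e : ℝ}

/-- Soundness of the search: no term of a cycle meets constraints that a tree refutes. -/
lemma false_of_check (h : IsCycle x y p a) (hd : 0 < 1 + x - y)
    (hE : ∀ n, |(1 + x - y) * a n| ≤ E.eval (y - 1) (1 + x - y) e) (t : SearchTree)
    (Γ : List Constraint) (s : ℤ) (f : AffineForm) (lb : Option ℤ) (n : ℕ)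
    (ht : t.check E Γ s f lb = true) (hs : a n + a (n + 1) = s)
    (hf : (1 + x - y) * a n = f.eval (y - 1) (1 + x - y) e)
    (hΓ : ∀ c ∈ Γ, c.Holds (y - 1) (1 + x - y) e)
    (hlb : ∀ k ∈ lb, k ≤ a (n + 1) + a (n + 2)) : False := by
  induction t generalizing Γ s f lb n with
  | contra l => exact false_of_refutes hΓ ht
  | next k below t ih =>
    simp only [SearchTree.check, Bool.and_eq_true] at ht
    by_cases hk : k ≤ a (n + 1) + a (n + 2)
    · exact ih Γ s f (some k) n ht.2 hs hf hΓ (by simpa using hk)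
    · refine false_of_refutes (w := y - 1) (d := 1 + x - y) (e := e) ?_ ht.1
      have h1 := h.sum_recurrence n
      have h2 := abs_le.1 (hE (n + 2))
      rw [hs] at h1
      have hk' : ((a (n + 1) + a (n + 2) : ℤ) : ℝ) ≤ ((k - 1 : ℤ) : ℝ) := by
        exact_mod_cast (by omega)
      have hs' : (a n : ℝ) + a (n + 1) = s := by exact_mod_cast hs
      have h3 := mul_le_mul_of_nonneg_left hk' hd.le
      push_cast at h1 h3 hk'
      simp only [belowConstraints, List.cons_append, List.nil_append, List.mem_cons,
        forall_eq_or_imp, Constraint.Holds, AffineForm.eval_add, AffineForm.eval_mk, ← hf]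
      push_cast
      refine ⟨⟨?_, by simp⟩, ⟨?_, by simp⟩, hΓ⟩
      · rw [← hs']; nlinarith
      · nlinarith
  | value t t' ih ih' =>
    cases lb with
    | none => simp [SearchTree.check] at ht
    | some k =>
      simp only [SearchTree.check, Bool.and_eq_true] at ht
      have hk : k ≤ a (n + 1) + a (n + 2) := hlb k rfl
      rcases hk.eq_or_lt with hk | hk
      · have hs' : (a n : ℝ) + a (n + 1) = s := by exact_mod_cast hs
        refine ih _ k _ none (n + 1) ht.1 hk.symm ?_ ?_ (by simp)
        · simp only [AffineForm.eval_add, AffineForm.eval_neg, AffineForm.eval_mk, ← hf, ← hs']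
          push_cast
          ring
        · have h1 := h.sum_recurrence n
          have h2 := abs_le.1 (hE (n + 2))
          have h4 := h.abs_sum_le hE (n + 1)
          simp only [add_assoc, Nat.reduceAdd] at h4
          have hk' : (k : ℝ) = a (n + 1) + a (n + 2) := by exact_mod_cast hk
          rw [hs] at h1
          rw [← hk] at h1 h4
          have e4 : ((k.natAbs : ℤ) : ℝ) = |(k : ℝ)| := by rw [Int.natCast_natAbs, Int.cast_abs]
          simp only [stepConstraints, List.cons_append, List.nil_append, List.mem_cons,
            forall_eq_or_imp, Constraint.Holds, AffineForm.eval_add, AffineForm.eval_neg,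
            AffineForm.eval_mk, ← hf, Int.cast_add, Int.cast_neg, e4]
          push_cast
          refine ⟨⟨?_, by simp⟩, ⟨?_, by simp⟩, ⟨?_, by simp⟩, ⟨?_, fun _ => ?_⟩, ⟨?_, by simp⟩,
            hΓ⟩
          · linarith
          · rw [← hs', hk']; linarith
          · rw [← hs', hk']; linarith
          · linarith
          · linarith
          · linarith
      · exact ih' Γ s f _ n ht.2 hs hf hΓ (by simpa using hk)
  | above l =>
    cases lb with
    | none => simp [SearchTree.check] at ht
    | some k =>
      have hk : k ≤ a (n + 1) + a (n + 2) := hlb k rfl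
      refine false_of_refutes (w := y - 1) (d := 1 + x - y) (e := e) ?_ ht
      have h1 := h.sum_recurrence n
      have h2 := abs_le.1 (hE (n + 2))
      rw [hs] at h1
      have hk' : (k : ℝ) ≤ ((a (n + 1) + a (n + 2) : ℤ) : ℝ) := by exact_mod_cast hk
      have hs' : (a n : ℝ) + a (n + 1) = s := by exact_mod_cast hs
      have h3 := mul_le_mul_of_nonneg_left hk' hd.le
      push_cast at h1 h3 hk'
      simp only [aboveConstraints, List.cons_append, List.nil_append, List.mem_cons,
        forall_eq_or_imp, Constraint.Holds, AffineForm.eval_add, AffineForm.eval_neg,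
        AffineForm.eval_mk, ← hf]
      push_cast
      refine ⟨⟨?_, by simp⟩, ⟨?_, fun _ => ?_⟩, hΓ⟩
      · rw [← hs']; nlinarith
      · nlinarith
      · nlinarith

lemma false_of_checkList (h : IsCycle x y p a) (hd : 0 < 1 + x - y)
    (hE : ∀ n, |(1 + x - y) * a n| ≤ E.eval (y - 1) (1 + x - y) e) {f : AffineForm}
    {Γ : ℤ → List Constraint} {τ : ℤ} {l : List SearchTree} {j : ℤ}
    (hl : checkList E f Γ τ j l = true) {n : ℕ} {i : ℤ} (hji : j ≤ i) (hil : i < j + l.length)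
    (hs : a n + a (n + 1) = τ * i) (hf : (1 + x - y) * a n = f.eval (y - 1) (1 + x - y) e)
    (hΓ : ∀ c ∈ Γ i, c.Holds (y - 1) (1 + x - y) e) : False := by
  induction l generalizing j with
  | nil => simp at hil; omega
  | cons t l ih =>
    simp only [checkList, Bool.and_eq_true] at hl
    rcases hji.eq_or_lt with rfl | hlt
    · exact h.false_of_check hd hE t _ _ f none n hl.1 hs hf hΓ (by simp)
    · exact ih hl.2 (by omega) (by simp at hil; omega)

end IsCycle

/-! ### Size estimates -/

section Estimates

variable {x y : ℝ} {p : ℕ} {u : ℕ → ℝ}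

/-- If the roots `α`, `conj α` of `t² + y t + x` are not real, then the numbers
`c n = u (n + 1) - α u n` satisfy `c (n + 1) = conj α * c n + O(1)`, hence are bounded if
`‖α‖ = √x > 1`; the imaginary part of `c n` is a multiple of `u n`. -/
lemma mul_sq_le_of_sq_lt (hp : 0 < p) (hper : Function.Periodic u p)
    (hu : ∀ n, |x * u n + y * u (n + 1) + u (n + 2)| ≤ 1 / 2) (hx : 1 < x) (hy : y ^ 2 < 4 * x)
    (n : ℕ) : (x - y ^ 2 / 4) * u n ^ 2 * (√x - 1) ^ 2 ≤ 1 / 4 := by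
  set κ := x - y ^ 2 / 4 with hκ
  have hκ0 : 0 < κ := by rw [hκ]; linarith
  have hsx : 1 < √x := by rw [Real.lt_sqrt (by norm_num)]; linarith
  set α : ℂ := ⟨-y / 2, √κ⟩ with hα
  have hnorm : ‖(starRingEnd ℂ) α‖ = √x := by
    rw [Complex.norm_conj, Complex.norm_def, Complex.normSq_apply]
    congr 1
    rw [hα]
    simp only
    rw [Real.mul_self_sqrt hκ0.le, hκ]
    ring
  set c : ℕ → ℂ := fun n => u (n + 1) - α * u n with hc
  have hstep (n : ℕ) : c (n + 1) = (starRingEnd ℂ) α * c n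
      + ((x * u n + y * u (n + 1) + u (n + 2) : ℝ) : ℂ) := by
    simp only [hc, hα, add_assoc, Nat.reduceAdd]
    apply Complex.ext
    · simp
      have := Real.mul_self_sqrt hκ0.le
      rw [hκ] at this ⊢
      linear_combination (u n) * this
    · simp
      ring_nf
  obtain ⟨N, hN⟩ := exists_forall_le_of_periodic (f := fun n => ‖c n‖) hp
    (fun n => by simp only [hc, add_right_comm n p 1, hper n, hper (n + 1)])
  have h1 : √x * ‖c (N + 1)‖ ≤ ‖c (N + 2)‖ + 1 / 2 := by
    have e : (starRingEnd ℂ) α * c (N + 1)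
        = c (N + 2) - ((x * u (N + 1) + y * u (N + 2) + u (N + 3) : ℝ) : ℂ) := by
      have := hstep (N + 1)
      simp only [add_assoc, Nat.reduceAdd] at this
      rw [eq_sub_iff_add_eq, add_assoc (x * u (N + 1))]
      exact this.symm
    rw [← hnorm, ← norm_mul, e]
    refine (norm_sub_le _ _).trans ?_
    rw [Complex.norm_real]
    exact add_le_add le_rfl (hu (N + 1))
  have h2 := hN (N + 2)
  have h3 : (√x - 1) * ‖c n‖ ≤ 1 / 2 := by
    have := mul_le_mul_of_nonneg_left (hN n) (by linarith : 0 ≤ √x - 1)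
    linarith
  have h4 : √κ * |u n| ≤ ‖c n‖ := by
    have := Complex.abs_im_le_norm (c n)
    have e : (c n).im = -(√κ * u n) := by simp [hc, hα]
    rwa [e, abs_neg, abs_mul, abs_of_nonneg (Real.sqrt_nonneg κ)] at this
  have h5 : (√x - 1) * (√κ * |u n|) ≤ 1 / 2 :=
    (mul_le_mul_of_nonneg_left h4 (by linarith)).trans h3
  have h6 : ((√x - 1) * (√κ * |u n|)) ^ 2 ≤ (1 / 2) ^ 2 := by
    refine pow_le_pow_left₀ ?_ h5 2
    have : 0 ≤ √x - 1 := by linarith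
    positivity
  rw [mul_pow, mul_pow, Real.sq_sqrt hκ0.le, sq_abs] at h6
  linarith

/-- The numbers `c n = u (n + 1) + (y / 2) u n` satisfy
`c (n + 1) = -(y / 2) c n - (x - y² / 4) u n + O(1)`; here `y / 2 > 1`, so that a bound for `c`
and one for `u` in terms of `c` follow. -/
lemma mul_le_of_two_lt (hp : 0 < p) (hper : Function.Periodic u p)
    (hu : ∀ n, |x * u n + y * u (n + 1) + u (n + 2)| ≤ 1 / 2) (hy : 2 < y) {N : ℕ}
    (hN : ∀ n, |u n| ≤ |u N|) :
    |u N| * (y / 2 - 1) ^ 2 ≤ |x - y ^ 2 / 4| * |u N| + 1 / 2 := by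
  set K := |u N| with hK
  set κ := x - y ^ 2 / 4 with hκ
  set c : ℕ → ℝ := fun n => u (n + 1) + y / 2 * u n with hc
  obtain ⟨m, hm⟩ := exists_forall_le_of_periodic (f := fun n => |c n|) hp
    (fun n => by simp only [hc, add_right_comm n p 1, hper n, hper (n + 1)])
  have h1 : y / 2 * |c (m + 1)| ≤ |c (m + 2)| + |κ| * K + 1 / 2 := by
    have e : y / 2 * c (m + 1) = -c (m + 2) - κ * u (m + 1)
        + (x * u (m + 1) + y * u (m + 2) + u (m + 3)) := by
      simp only [hc, hκ, add_assoc, Nat.reduceAdd]; ring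
    have h2 := hu (m + 1)
    simp only [add_assoc, Nat.reduceAdd] at h2
    calc y / 2 * |c (m + 1)| = |y / 2 * c (m + 1)| := by
          rw [abs_mul, abs_of_pos (by linarith : 0 < y / 2)]
      _ ≤ |-c (m + 2) - κ * u (m + 1)| + |x * u (m + 1) + y * u (m + 2) + u (m + 3)| := by
          rw [e, add_assoc (x * u (m + 1))]; exact abs_add_le _ _
      _ ≤ |c (m + 2)| + |κ| * |u (m + 1)| + 1 / 2 := by
          have := abs_sub (-c (m + 2)) (κ * u (m + 1))
          rw [abs_neg, abs_mul] at this
          simp only [add_assoc] at h2 ⊢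
          linarith
      _ ≤ _ := by
          have := mul_le_mul_of_nonneg_left (hN (m + 1)) (abs_nonneg κ)
          linarith
  have h2 := hm (m + 2)
  have h3 : K * (y / 2 - 1) ≤ |c (m + 1)| := by
    have e : y / 2 * u N = c N - u (N + 1) := by simp only [hc]; ring
    have h4 : y / 2 * K ≤ |c N| + |u (N + 1)| := by
      calc y / 2 * K = |y / 2 * u N| := by rw [abs_mul, abs_of_pos (by linarith : 0 < y / 2)]
        _ ≤ |c N| + |u (N + 1)| := by rw [e]; exact abs_sub _ _
    have h5 := hN (N + 1)
    have h6 := hm N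
    linarith
  have h4 := mul_le_mul_of_nonneg_right h3 (by linarith : 0 ≤ y / 2 - 1)
  nlinarith

/-- For small `z = r * K` the first two hypotheses bound the left-hand side by `1 / (4 z) + z`,
which is at most `1.93` for `0.1405 ≤ z ≤ 1 / 2`; for large `z` the first and the third one
bound it by `1 / 2 + 1 / (2 z)`. -/
lemma add_mul_le_of_le {κ t r K : ℝ} (h1 : κ * K * (r * K) ≤ 1 / 4) (h2 : t ≤ r)
    (h3 : K * t ≤ κ * K + 1 / 2) (hK : 0 ≤ K) (hz : 0.1405 ≤ r * K) : (κ + t) * K ≤ 1.93 := by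
  rcases le_or_gt (r * K) (1 / 2) with hz1 | hz1
  · have h4 : t * K ≤ r * K := mul_le_mul_of_nonneg_right h2 hK
    have h5 : κ * K ≤ 1.93 - r * K := by
      by_contra hcon
      push Not at hcon
      have h6 : (1.93 - r * K) * (r * K) < κ * K * (r * K) :=
        mul_lt_mul_of_pos_right hcon (by linarith)
      have h7 : 0 ≤ (r * K - 0.1405) * (1 / 2 - r * K) :=
        mul_nonneg (by linarith) (by linarith)
      linarith
    linarith
  · have h4 : κ * K ≤ 1 / 2 := by
      by_contra hcon
      push Not at hcon
      have : (1 / 2 : ℝ) * (1 / 2) < κ * K * (r * K) :=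
        mul_lt_mul'' hcon hz1 (by norm_num) (by norm_num)
      linarith
    linarith

end Estimates

namespace IsCycle

variable {x y : ℝ} {p : ℕ} {a : ℕ → ℤ}

/-- Terms of modulus at least `6` occur only for `y ≥ 2`, and they are of size `O(1 / (1 + x - y))`.
Indeed `1 + x - y = (x - y² / 4) + (y / 2 - 1)²`, and `mul_sq_le_of_sq_lt` and `mul_le_of_two_lt`
bound the products of the two summands with the modulus. -/
lemma two_le_and_mul_le (h : IsCycle x y p a) (hx : 4 / 3 ≤ x) (h0 : 0 ≤ x + y)
    (h5 : x + y < 5) (h5' : x - y < 5) (hd : y < x + 1) {N : ℕ}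
    (h6 : 6 ≤ |a N|) : 2 ≤ y ∧ (1 + x - y) * |(a N : ℝ)| ≤ 2 := by
  set M : ℝ := |(a N : ℝ)| with hM
  have hM6 : (6 : ℝ) ≤ M := by rw [hM]; exact_mod_cast h6
  -- the shift by the fixed point makes the interval `[0, 1)` symmetric
  set m : ℝ := 1 / (2 * (1 + x + y)) with hm
  have hT : 0 < 1 + x + y := by linarith
  have hmT : m * (1 + x + y) = 1 / 2 := by rw [hm]; field_simp
  have hm0 : 0 < m := by rw [hm]; positivity
  set u : ℕ → ℝ := fun n => a n - m with hu
  have hper : Function.Periodic u p := fun n => by simp only [hu, h.periodic n]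
  have hub (n : ℕ) : |x * u n + y * u (n + 1) + u (n + 2)| ≤ 1 / 2 := by
    have h1 := h.nonneg n
    have h2 := h.lt_one n
    simp only [hu]
    rw [abs_le]
    constructor <;> linarith
  obtain ⟨N', hN'⟩ := exists_forall_le_of_periodic (f := fun n => |u n|) h.pos
    (fun n => by simp only [hper n])
  set K := |u (N' + 1)| with hK
  have hMK : M ≤ K + m := by
    have h1 := hN' N
    have h2 := abs_add_le (u N) m
    rw [abs_of_pos hm0] at h2
    simp only [hu, sub_add_cancel] at h1 h2
    linarith
  set κ := x - y ^ 2 / 4 with hκ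
  set ρ := √x - 1 with hρ
  -- `0.1547` is slightly less than `√(4 / 3) - 1`
  have hρ0 : 0.1547 ≤ ρ := by
    have : 1.1547 ≤ √x := by
      rw [Real.le_sqrt' (by norm_num)]
      refine le_trans ?_ hx
      norm_num
    linarith
  have hρ2 : 0.0239 ≤ ρ ^ 2 := by nlinarith
  have hρx : (1 + ρ) ^ 2 = x := by
    rw [hρ, add_sub_cancel, Real.sq_sqrt (by linarith)]
  have hκK : 0 < κ → κ * K ^ 2 * ρ ^ 2 ≤ 1 / 4 := fun hκ0 => by
    have := mul_sq_le_of_sq_lt h.pos hper hub (by linarith) (by linarith : y ^ 2 < 4 * x) (N' + 1)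
    rwa [← sq_abs (u (N' + 1)), ← hK] at this
  have hK5 : 5.5 ≤ K := by
    have := mul_le_mul_of_nonneg_left (by linarith : 1 ≤ 1 + x + y) hm0.le
    linarith
  -- a first bound for `κ` yields `y > 0`, hence a smaller shift `m` and a better bound
  have hκ1 : κ ≤ 0.346 := by
    by_contra hcon
    push Not at hcon
    have h1 := hκK (by linarith)
    have h2 : (5.5 : ℝ) ^ 2 ≤ K ^ 2 := by gcongr
    have hκ0 : 0 < κ := by linarith
    have h3 : κ * (5.5 ^ 2 * 0.0239) ≤ κ * (K ^ 2 * ρ ^ 2) := by gcongr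
    linarith
  have hy1 : 1.98 ≤ y := by
    by_contra hcon
    push Not at hcon
    have h1 : 3.93 ≤ y ^ 2 := by linarith
    have h2 : y ≤ -1.98 := by nlinarith
    have h3 : y ^ 2 ≤ x ^ 2 := by nlinarith
    nlinarith
  have hm1 : m ≤ 0.1165 := by
    have := mul_le_mul_of_nonneg_left (by linarith : 4.3 ≤ 1 + x + y) hm0.le
    linarith
  have hK1 : 5.88 ≤ K := by linarith
  have hκ2 : κ ≤ 0.304 := by
    by_contra hcon
    push Not at hcon
    have h1 := hκK (by linarith)
    have h2 : (5.88 : ℝ) ^ 2 ≤ K ^ 2 := by gcongr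
    have hκ0 : 0 < κ := by linarith
    have h3 : κ * (5.88 ^ 2 * 0.0239) ≤ κ * (K ^ 2 * ρ ^ 2) := by gcongr
    linarith
  have hy2 : 2 < y := by nlinarith
  refine ⟨hy2.le, ?_⟩
  have hθ := mul_le_of_two_lt h.pos hper hub hy2 (N := N' + 1) hN'
  rw [← hK, ← hκ] at hθ
  have hδ : 1 + x - y = κ + (y / 2 - 1) ^ 2 := by rw [hκ]; ring
  have hδ0 : 0 < 1 + x - y := by linarith
  suffices hδK : (1 + x - y) * K ≤ 1.93 by
    have h1 : (1 + x - y) * M ≤ (1 + x - y) * (K + m) := mul_le_mul_of_nonneg_left hMK hδ0.le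
    have h2 : (1 + x - y) * 5.88 ≤ 1.93 := (mul_le_mul_of_nonneg_left hK1 hδ0.le).trans hδK
    have h3 : (1 + x - y) * m ≤ (1 + x - y) * 0.1165 := mul_le_mul_of_nonneg_left hm1 hδ0.le
    linarith
  rw [hδ]
  rcases le_or_gt κ 0 with hκ0 | hκ0
  · rw [abs_of_nonpos hκ0] at hθ
    linarith
  · rw [abs_of_pos hκ0] at hθ
    have h1 := hκK hκ0
    have h2 : (y / 2 - 1) ^ 2 ≤ ρ ^ 2 := by
      have : (y / 2) ^ 2 ≤ (1 + ρ) ^ 2 := by rw [hρx]; linarith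
      have := (pow_le_pow_iff_left₀ (by linarith) (by linarith) two_ne_zero).1 this
      exact pow_le_pow_left₀ (by linarith) (by linarith) 2
    refine add_mul_le_of_le (by linarith) h2 (by linarith) (by linarith) ?_
    have : (0.0239 : ℝ) * 5.88 ≤ ρ ^ 2 * K := by gcongr
    norm_num at this
    linarith

end IsCycle

/-! ### Translation to orbits -/

lemma orbit_add_two (r : ℝ × ℝ) (a : ℤ × ℤ) (n : ℕ) :
    orbit r a (n + 2) = -⌊r.1 * orbit r a n + r.2 * orbit r a (n + 1)⌋ := by
  simp only [orbit, Function.iterate_succ_apply', tau]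

/-- A parameter belongs to `𝒟₂^(*)` if all its cycles are trivial. -/
lemma mem_DStar_of_forall {r : ℝ × ℝ}
    (H : ∀ (p : ℕ) (a : ℕ → ℤ), IsCycle r.1 r.2 p a → ∀ n, a n = 0) : r ∈ DStar := by
  rintro a ⟨n₀, p, hp, hper⟩
  refine ⟨n₀, fun n hn => ?_⟩
  have hrec (n : ℕ) : r.1 * orbit r a n + r.2 * orbit r a (n + 1) + orbit r a (n + 2)
      = Int.fract (r.1 * orbit r a n + r.2 * orbit r a (n + 1)) := by
    rw [orbit_add_two, Int.fract]
    push_cast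
    ring
  have hcyc : IsCycle r.1 r.2 p (fun n => orbit r a (n₀ + n)) :=
    { pos := hp
      periodic := fun n => by
        simp only [← add_assoc]
        exact hper _ (by omega)
      nonneg := fun n => by
        have := hrec (n₀ + n)
        simp only [← add_assoc]
        rw [this]
        exact Int.fract_nonneg _
      lt_one := fun n => by
        have := hrec (n₀ + n)
        simp only [← add_assoc]
        rw [this]
        exact Int.fract_lt_one _ }
  have := H p _ hcyc (n - n₀)
  simpa [Nat.add_sub_cancel' hn] using this

/-- A parameter with a nontrivial cycle of period at most two does not belong to `𝒟₂^(*)`. -/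
lemma notMem_DStar_of_cycle {r : ℝ × ℝ} {u v : ℤ} (h0 : u ≠ 0 ∨ v ≠ 0)
    (h1 : 0 ≤ r.1 * u + r.2 * v + u ∧ r.1 * u + r.2 * v + u < 1)
    (h2 : 0 ≤ r.1 * v + r.2 * u + v ∧ r.1 * v + r.2 * u + v < 1) : r ∉ DStar := by
  intro hr
  have e1 : tau r (u, v) = (v, u) := by
    have : ⌊r.1 * u + r.2 * v⌋ = -u := by
      rw [Int.floor_eq_iff]
      push_cast
      constructor <;> linarith
    simp [tau, this]
  have e2 : tau r (v, u) = (u, v) := by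
    have : ⌊r.1 * v + r.2 * u⌋ = -v := by
      rw [Int.floor_eq_iff]
      push_cast
      constructor <;> linarith
    simp [tau, this]
  have e3 (n : ℕ) : (tau r)^[n + 2] (u, v) = (tau r)^[n] (u, v) := by
    rw [Function.iterate_add_apply]
    congr 1
    simp [e1, e2]
  have e4 (n : ℕ) : orbit r (u, v) (2 * n) = u ∧ orbit r (u, v) (2 * n + 1) = v := by
    induction n with
    | zero => simp [orbit, e1]
    | succ n ih =>
      refine ⟨?_, ?_⟩
      · have := congrArg Prod.fst (e3 (2 * n))
        exact this.trans ih.1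
      · have := congrArg Prod.fst (e3 (2 * n + 1))
        exact this.trans ih.2
  obtain ⟨n₀, hn₀⟩ := hr (u, v) ⟨0, 2, by norm_num, fun n _ => by rw [orbit, orbit, e3]⟩
  rcases h0 with h0 | h0
  · exact h0 (by rw [← (e4 n₀).1]; exact hn₀ _ (by omega))
  · exact h0 (by rw [← (e4 n₀).2]; exact hn₀ _ (by omega))

lemma notMem_obviousCycles_of_mem_DStar {r : ℝ × ℝ} (hr : r ∈ DStar) : r ∉ obviousCycles := by
  rintro (((⟨h1, h2⟩ | h) | ⟨⟨h1, h2⟩, h3, h4⟩) | ⟨⟨h1, h2⟩, h3, h4⟩)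
  · rcases le_or_gt (r.1 + r.2) (-1) with h | h
    · refine notMem_DStar_of_cycle (u := -1) (v := -1) (by norm_num) ?_ ?_ hr <;> push_cast <;>
        constructor <;> linarith
    · refine notMem_DStar_of_cycle (u := 1) (v := 1) (by norm_num) ?_ ?_ hr <;> push_cast <;>
        constructor <;> linarith
  · have h : r.2 = r.1 + 1 := h
    refine notMem_DStar_of_cycle (u := 1) (v := -1) (by norm_num) ?_ ?_ hr <;> push_cast <;>
      constructor <;> linarith
  · refine notMem_DStar_of_cycle (u := 0) (v := -1) (by norm_num) ?_ ?_ hr <;> push_cast <;>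
      constructor <;> linarith
  · refine notMem_DStar_of_cycle (u := 0) (v := 1) (by norm_num) ?_ ?_ hr <;> push_cast <;>
      constructor <;> linarith

/-! ### The regions of parameters -/

lemma mem_schurCohn {r : ℝ × ℝ} (h0 : 0 ≤ r.1) (h1 : r.1 < 1) (h2 : -r.1 ≤ r.2)
    (h3 : r.2 < r.1 + 1) : r ∈ schurCohn := by
  intro z hz
  have hre := congrArg Complex.re hz
  have him := congrArg Complex.im hz
  simp [sq] at hre him
  rw [← sq_lt_one_iff₀ (norm_nonneg z), Complex.sq_norm, Complex.normSq_apply]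
  have him' : z.im * (2 * z.re + r.2) = 0 := by linarith
  rcases mul_eq_zero.1 him' with h | h
  · rw [h] at hre ⊢
    by_contra hcon
    push Not at hcon
    have : 1 ≤ |z.re| := by
      rw [← one_le_sq_iff_one_le_abs]
      linarith
    rcases le_abs.1 this with h' | h'
    · nlinarith
    · nlinarith
  · have : r.2 = -2 * z.re := by linarith
    rw [this] at hre
    nlinarith

lemma isBounded_unsettled : Bornology.IsBounded unsettled := by
  refine ((Metric.isBounded_Icc (0 : ℝ) 5).prod (Metric.isBounded_Icc (-5 : ℝ) 5)).subset ?_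
  rintro ⟨x, y⟩ hr
  simp only [unsettled, obviousCycles, simpleOrbits, notSoSimpleOrbits, largeParameters,
    stripOverParabola, Set.mem_compl_iff, Set.mem_union, Set.mem_ofPred_eq, Set.mem_sdiff,
    not_or, not_and, not_lt, not_le] at hr
  obtain ⟨⟨⟨⟨⟨⟨⟨hO1, hO2⟩, hO3⟩, hO4⟩, ⟨hS1, hS2⟩, hS3⟩, hN⟩, hL⟩, hP⟩ := hr
  have hxy : 0 ≤ x + y := by
    by_contra hcon
    push Not at hcon
    have h2 : x + y ≤ -2 := by
      by_contra h
      push Not at h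
      exact absurd (hO1 h) (by linarith)
    obtain ⟨h3, h4⟩ : -2 < x ∧ -1 < y := by
      have := hS2 ⟨h2, fun h => hO2 (by linarith)⟩
      push Not at this
      exact this
    exact absurd (hO3 ⟨h3, by linarith⟩ h4) (by linarith)
  have hx : 0 ≤ x := by
    by_contra hx
    push Not at hx
    have hy := hS3 hxy hx
    exact absurd (hO4 ⟨by linarith, hx⟩ (by linarith)) (by linarith)
  have hd : -1 < x - y := by
    have h1 : -1 ≤ x - y := by
      by_contra h
      push Not at h
      exact absurd (hN h) (by linarith)
    exact lt_of_le_of_ne h1 fun h => hO2 (by linarith)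
  have hs2 : √2 ≤ 1.42 := by rw [Real.sqrt_le_left (by norm_num)]; norm_num
  have hs5 : √5 ≤ 2.24 := by rw [Real.sqrt_le_left (by norm_num)]; norm_num
  have hx5 : x ≤ 5 := by
    by_contra hcon
    push Not at hcon
    have hroot : -2 * √x < y := by
      by_contra h
      push Not at h
      exact absurd (hS1 (by linarith) h) (by linarith)
    have h1 : x - y ≤ -(1 / 2) := by
      by_contra h
      push Not at h
      have := hL h (max_le hroot.le (by linarith))
      linarith
    have := hP ⟨hd, h1⟩ (by linarith)
    nlinarith
  have hy5 : y ≤ 5 := by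
    by_contra hcon
    push Not at hcon
    have h1 : x - y ≤ -(1 / 2) := by
      by_contra h
      push Not at h
      have := hL h (max_le (by have := Real.sqrt_nonneg x; linarith) (by linarith))
      linarith
    have := hP ⟨hd, h1⟩ (by linarith)
    nlinarith
  exact ⟨⟨hx, hx5⟩, by linarith, hy5⟩

/-! ### The search trees -/

/-- The constraints on `w = y - 1` and `d = 1 + x - y` that say that `(x, y)` satisfies `x ≥ 4 / 3`,
`0 ≤ x + y < 5`, `x - y < 5` and `y < x + 1`. -/
def smallConstraints (_ : ℤ) : List Constraint :=
  [⟨false, ⟨1, 2, 1, 0⟩⟩, ⟨true, ⟨4, -2, -1, 0⟩⟩, ⟨true, ⟨6, 0, -1, 0⟩⟩, ⟨false, ⟨-4, 3, 3, 0⟩⟩,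
    ⟨true, ⟨0, 0, 1, 0⟩⟩]

/-- The constraints on `w = y - 1`, `d = 1 + x - y` and `e = d * M` that hold if the maximal modulus
`M` of the terms is at least `6`, namely `e ≥ j - 1`, `x + y < 5`, `e ≤ 2`, `e ≥ 6 d`, `y ≥ 2`,
`x ≥ 4 / 3` and `y < x + 1`; here `± j` is the sum of a term of maximal modulus and its
successor. -/
def largeConstraints (j : ℤ) : List Constraint :=
  [⟨false, ⟨1 - j, 0, 0, 1⟩⟩, ⟨true, ⟨4, -2, -1, 0⟩⟩, ⟨false, ⟨2, 0, 0, -1⟩⟩,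
    ⟨false, ⟨0, 0, -6, 1⟩⟩, ⟨false, ⟨-1, 1, 0, 0⟩⟩, ⟨false, ⟨-4, 3, 3, 0⟩⟩, ⟨true, ⟨0, 0, 1, 0⟩⟩]

open SearchTree in
/-- The search trees for the maximal term `a₀ = 1` and `s₀ = 0, 1, …, 2`. -/
def searchTreesOnePos : List SearchTree := [
    next (-2) [(0,1), (6,1)] (value (next 0 [(1,3), (5,3), (10,2)] (value (next 3 [(1,3), (6,3),
    (15,2)] (above [(0,1), (1,1)])) (above [(0,1), (6,1)]))) (value (next 2 [(1,3), (10,1)] (above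
    [(0,1), (6,1)])) (value (next 1 [(1,1), (11,1)] (value (next (-1) [(0,1), (5,1)] (value (next
    1 [(1,1), (6,1), (15,1)] (above [(0,1), (21,1)])) (above [(1,3), (15,1)]))) (above [(1,1),
    (5,1)]))) (above [(1,1), (6,1)])))),
    next (-1) [(0,1), (6,1)] (value (next (-2) [(0,1), (11,1)] (value (next (-1) [(1,1), (12,1)]
    (value (next 2 [(1,3), (20,1)] (above [(0,1), (21,1)])) (value (next 4 [(1,1), (5,1), (11,2)]
    (above [(0,1), (1,2)])) (above [(0,1), (16,1)])))) (value (next 2 [(1,3), (15,1)] (above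
    [(0,1), (16,1)])) (value (next 2 [(1,3), (6,3), (15,1)] (value (next 0 [(0,1), (5,1)] (value
    (next (-2) [(0,1), (1,1)] (value (next 1 [(1,1), (6,1), (20,2)] (above [(0,1), (6,1)])) (value
    (next 2 [(1,3), (30,1)] (above [(0,1), (6,1)])) (above [(1,1), (10,1)])))) (above [(1,3),
    (6,3), (20,2)]))) (above [(0,1), (1,1)]))) (above [(0,1), (11,1)]))))) (above [(1,3), (5,1)])),
    next 0 [(0,1), (6,1)] (value (next (-2) [(0,1), (1,1)] (value (next 0 [(1,1), (11,1)] (value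
    (next 3 [(1,3), (6,3), (20,2)] (above [(0,1), (1,1)])) (above [(0,1), (6,1)]))) (value (next 2
    [(1,3), (15,1)] (above [(0,1), (6,1)])) (above [(1,3), (5,3), (10,2)])))) (value (next (-1)
    [(0,1), (11,1)] (value (next (-2) [(0,1), (16,1)] (value (next (-1) [(1,1), (17,1)] (value
    (next 2 [(1,3), (25,1)] (above [(0,1), (26,1)])) (value (next 4 [(1,1), (5,1), (11,2)] (above
    [(0,1), (1,2)])) (above [(1,1), (15,1)])))) (value (next 2 [(1,3), (20,1)] (above [(0,1),
    (21,1)])) (above [(1,1), (6,1), (10,1)])))) (above [(1,3), (10,1)]))) (above [(1,1), (2,1)])))]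

open SearchTree in
/-- The search trees for the maximal term `a₀ = -1` and `s₀ = 0, -1, …, -2`. -/
def searchTreesOneNeg : List SearchTree := [
    next 1 [(1,1), (6,1)] (value (next (-1) [(0,1), (5,1)] (value (next 1 [(1,3), (11,3), (15,1)]
    (above [(0,1), (16,1)])) (above [(1,3), (10,1)]))) (value (next 0 [(0,1), (5,1)] (value (next
    (-2) [(0,1), (1,1)] (value (next 1 [(1,3), (16,3), (20,2)] (above [(0,1), (6,1)])) (value
    (next 2 [(1,3), (20,1)] (above [(0,1), (6,1)])) (above [(1,1), (10,1)])))) (above [(1,3),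
    (6,3), (10,2)]))) (above [(0,1), (6,1)]))),
    next 2 [(1,3), (5,1)] (above [(0,1), (6,1)]),
    next (-1) [(1,1), (2,1)] (value (next 2 [(1,3), (10,1)] (above [(0,1), (11,1)])) (value (next
    3 [(1,3), (6,3), (10,2)] (above [(0,1), (1,1)])) (above [(0,1), (6,1)])))]

open SearchTree in
/-- The search trees for the maximal term `a₀ = 2` and `s₀ = 0, 1, …, 4`. -/
def searchTreesTwoPos : List SearchTree := [
    next (-4) [(0,1), (6,1)] (value (next 1 [(1,3), (5,3), (10,4)] (above [(0,2), (6,1)])) (value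
    (next 3 [(1,2), (5,1), (10,2)] (above [(0,1), (6,1)])) (value (next 3 [(1,3), (10,2)] (above
    [(0,2), (6,1)])) (value (next 2 [(1,6), (6,3), (10,2)] (value (next (-1) [(0,1), (16,1)]
    (above [(1,1), (6,1), (15,1)])) (value (next 0 [(0,1), (16,1)] (above [(1,2), (5,6), (10,5)]))
    (above [(0,2), (6,1)])))) (value (next 1 [(1,1), (11,2)] (value (next (-2) [(1,4), (6,3),
    (13,2)] (value (next 3 [(1,2), (6,4), (15,3)] (above [(0,1), (21,2)])) (value (next 2 [(1,3),
    (20,1)] (value (next 0 [(0,1), (26,1)] (above [(1,1), (5,2), (20,1)])) (above [(0,1),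
    (21,1)]))) (above [(1,6), (5,3), (15,2)])))) (above [(1,1), (5,1)]))) (above [(1,1),
    (6,2)])))))),
    next (-3) [(0,1), (6,1)] (value (next (-1) [(1,3), (5,6), (10,5)] (value (next 4 [(1,6),
    (6,3), (15,5)] (above [(0,1), (16,1)])) (value (next 4 [(1,1), (6,1), (15,1)] (value (next 0
    [(0,2), (5,1)] (above [(1,3), (6,3), (20,4)])) (above [(0,2), (1,1)]))) (above [(0,1),
    (11,1)])))) (value (next 2 [(1,1), (5,1), (10,1)] (above [(0,1), (11,1)])) (value (next 2
    [(1,3), (10,1)] (value (next 0 [(0,1), (16,1)] (above [(1,3), (10,6), (15,4)])) (above [(0,1),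
    (11,1)]))) (above [(1,3), (5,1), (6,3)])))),
    next (-2) [(0,1), (6,1)] (value (next (-4) [(0,1), (11,1)] (value (next (-2) [(1,1), (12,2)]
    (value (next 3 [(1,3), (20,2)] (above [(0,1), (21,1)])) (value (next 5 [(1,2), (6,1), (20,2)]
    (above [(0,1), (21,2)])) (above [(1,1), (6,1), (10,1)])))) (value (next 1 [(1,6), (5,3),
    (15,4)] (value (next 5 [(1,3), (6,6), (20,5)] (above [(0,1), (21,1)])) (above [(0,1),
    (16,1)]))) (value (next 3 [(1,3), (15,2)] (above [(0,1), (16,1)])) (value (next 4 [(1,6),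
    (6,3), (15,4)] (above [(0,1), (16,1)])) (value (next 3 [(1,3), (6,3), (15,2)] (value (next
    (-1) [(0,2), (5,1)] (above [(1,2), (6,1), (20,2)])) (value (next 0 [(0,2), (5,1)] (above
    [(1,3), (6,3), (20,4)])) (above [(0,2), (1,1)])))) (above [(0,1), (11,1)]))))))) (above
    [(1,3), (5,2)])),
    next (-1) [(0,1), (6,1)] (value (next (-4) [(0,1), (11,1)] (value (next 0 [(1,1), (5,1),
    (15,1)] (value (next 6 [(1,3), (6,3), (20,4)] (above [(0,1), (1,1)])) (above [(0,1),
    (16,1)]))) (value (next 2 [(1,6), (5,3), (15,5)] (above [(0,1), (16,1)])) (value (next 3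
    [(1,3), (15,2)] (above [(0,1), (16,1)])) (above [(1,3), (5,6), (10,5)]))))) (value (next (-3)
    [(0,1), (1,1)] (value (next (-3) [(1,1), (5,2), (15,1)] (value (next 1 [(1,2), (5,1), (20,1)]
    (value (next 6 [(1,3), (5,4), (11,5)] (above [(0,1), (26,2)])) (above [(1,1), (15,1)])))
    (value (next 3 [(1,3), (20,2)] (above [(0,1), (21,1)])) (above [(1,1), (6,1), (10,1)]))))
    (above [(1,1), (5,1), (10,1)]))) (above [(1,3), (2,3), (5,1)]))),
    next 0 [(0,1), (6,1)] (value (next (-4) [(0,2), (1,1)] (value (next 1 [(1,3), (5,3), (15,4)]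
    (above [(0,2), (6,1)])) (above [(1,3), (5,3), (10,4)]))) (value (next (-3) [(0,1), (11,1)]
    (above [(1,2), (5,1), (10,2)])) (value (next (-2) [(0,1), (11,1)] (value (next (-4) [(0,1),
    (16,1)] (value (next (-2) [(1,1), (17,2)] (value (next 3 [(1,3), (25,2)] (above [(0,1),
    (26,1)])) (value (next 5 [(1,2), (6,1), (25,2)] (above [(0,1), (26,2)])) (above [(1,1),
    (15,1)])))) (value (next 1 [(1,6), (5,3), (20,4)] (value (next 6 [(1,1), (20,1), (25,1)]
    (above [(0,1), (26,2)])) (above [(0,1), (21,1)]))) (above [(1,1), (6,1), (10,1)])))) (above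
    [(1,3), (10,2)]))) (above [(1,1), (2,2)]))))]

open SearchTree in
/-- The search trees for the maximal term `a₀ = -2` and `s₀ = 0, -1, …, -4`. -/
def searchTreesTwoNeg : List SearchTree := [
    next 1 [(1,1), (6,2)] (value (next (-2) [(1,4), (6,3), (8,2)] (value (next 3 [(1,2), (6,4),
    (11,3)] (above [(0,1), (16,2)])) (value (next 2 [(1,3), (15,1)] (value (next 0 [(0,1), (21,1)]
    (above [(1,1), (5,2), (16,1)])) (above [(0,1), (16,1)]))) (above [(1,6), (5,3), (10,2)]))))
    (value (next (-2) [(0,2), (5,1)] (value (next 1 [(1,3), (11,3), (15,2)] (above [(0,1),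
    (16,1)])) (above [(1,3), (10,2)]))) (value (next (-1) [(0,2), (5,1)] (above [(1,2), (6,1),
    (10,2)])) (value (next 0 [(0,2), (5,1)] (above [(1,3), (6,3), (10,4)])) (above [(0,1),
    (6,1)]))))),
    next 2 [(1,3), (5,1), (6,3)] (value (next (-1) [(0,1), (11,1)] (above [(1,1), (6,1), (10,1)]))
    (value (next 0 [(0,1), (11,1)] (value (next (-3) [(1,5), (6,2), (11,6)] (value (next 3 [(1,2),
    (5,1), (20,2)] (above [(0,1), (6,1)])) (above [(1,1), (5,1), (15,1)]))) (above [(1,3), (6,6),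
    (10,5)]))) (above [(0,1), (6,1)]))),
    next 3 [(1,3), (5,2)] (above [(0,1), (6,1)]),
    next 1 [(1,3), (2,3), (5,1)] (value (next 5 [(1,3), (6,6), (10,5)] (above [(0,1), (11,1)]))
    (above [(0,1), (6,1)])),
    next (-2) [(1,1), (2,2)] (value (next 3 [(1,3), (10,2)] (above [(0,1), (11,1)])) (value (next
    5 [(1,2), (6,1), (10,2)] (above [(0,1), (11,2)])) (value (next 6 [(1,3), (6,3), (10,4)] (above
    [(0,1), (1,1)])) (above [(0,1), (6,1)]))))]

open SearchTree in
/-- The search trees for the maximal term `a₀ = 3` and `s₀ = 0, 1, …, 6`. -/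
def searchTreesThreePos : List SearchTree := [
    next (-6) [(0,1), (6,1)] (value (next 2 [(1,1), (5,1), (10,2)] (above [(0,3), (6,2)])) (value
    (next 3 [(1,3), (5,2), (10,5)] (above [(0,3), (6,2)])) (value (next 4 [(1,3), (5,1), (10,4)]
    (above [(0,3), (6,2)])) (value (next 4 [(1,1), (10,1)] (above [(0,3), (6,1)])) (value (next 4
    [(1,3), (6,1), (10,2)] (value (next 0 [(0,1), (16,1)] (above [(1,3), (5,6), (10,5)])) (above
    [(0,3), (6,1)]))) (value (next 2 [(1,3), (6,2), (10,1)] (value (next (-2) [(1,3), (6,6),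
    (11,4)] (value (next 2 [(1,3), (15,2), (20,2)] (above [(0,1), (21,1)])) (above [(1,3),
    (15,2)]))) (value (next (-2) [(0,1), (16,1)] (above [(1,6), (6,3), (15,7)])) (value (next (-1)
    [(0,1), (16,1)] (above [(1,3), (6,3), (15,5)])) (above [(1,6), (5,5), (8,3)]))))) (value (next
    1 [(1,1), (11,3)] (value (next (-2) [(1,6), (6,5), (13,3)] (value (next 3 [(1,3), (20,2)]
    (value (next 0 [(0,1), (26,1)] (above [(1,2), (5,3), (20,2)])) (above [(0,1), (21,1)])))
    (value (next 2 [(1,3), (8,3), (20,1)] (value (next (-2) [(0,1), (26,1)] (value (next 2 [(1,3),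
    (6,3), (25,2)] (above [(0,1), (31,2)])) (above [(1,1), (6,1), (25,1)]))) (above [(1,5), (5,5),
    (9,1)]))) (above [(1,3), (8,1), (15,1)])))) (above [(1,1), (5,1)]))) (above [(1,1),
    (6,3)])))))))),
    next (-5) [(0,1), (6,1)] (value (next 0 [(1,6), (5,9), (10,13)] (value (next 7 [(1,3), (6,3),
    (15,5)] (above [(0,3), (1,1)])) (above [(0,1), (11,1)]))) (value (next 2 [(1,3), (5,3),
    (10,5)] (above [(0,1), (11,1)])) (value (next 3 [(1,6), (5,3), (10,7)] (above [(0,1),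
    (11,1)])) (value (next 3 [(1,3), (10,2)] (value (next 0 [(0,1), (16,1)] (above [(1,2), (10,3),
    (15,3)])) (above [(0,1), (11,1)]))) (value (next 2 [(1,6), (6,3), (10,1)] (value (next (-2)
    [(0,1), (16,1)] (value (next 2 [(1,5), (6,7), (15,4)] (above [(0,1), (21,2)])) (above [(1,1),
    (6,1), (15,1)]))) (above [(1,5), (5,3), (8,1)]))) (above [(1,3), (5,1), (6,6)])))))),
    next (-4) [(0,1), (6,1)] (value (next (-1) [(1,3), (5,9), (10,10)] (value (next 6 [(1,9),
    (6,6), (15,11)] (above [(0,1), (16,1)])) (value (next 6 [(1,3), (6,3), (15,4)] (value (next 0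
    [(0,3), (5,1)] (above [(1,1), (6,1), (20,2)])) (above [(0,3), (1,1)]))) (above [(0,1),
    (11,1)])))) (value (next 2 [(1,3), (5,6), (10,7)] (above [(0,1), (11,1)])) (value (next 3
    [(1,3), (5,3), (10,4)] (above [(0,1), (11,1)])) (above [(1,3), (5,2), (6,3)])))),
    next (-3) [(0,1), (6,1)] (above [(1,1), (5,1)]),
    next (-2) [(0,1), (6,1)] (value (next (-6) [(0,1), (11,1)] (value (next (-1) [(1,3), (5,3),
    (15,4)] (value (next 8 [(1,3), (6,2), (20,5)] (above [(0,1), (21,3)])) (value (next 9 [(1,2),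
    (5,1), (11,3)] (above [(0,1), (1,1)])) (above [(0,1), (16,1)])))) (value (next 1 [(1,9),
    (5,6), (15,11)] (value (next 8 [(1,6), (6,9), (20,13)] (above [(0,1), (21,2)])) (above [(0,1),
    (16,1)]))) (value (next 3 [(1,9), (5,3), (15,10)] (above [(0,1), (16,1)])) (above [(1,3),
    (5,9), (10,10)]))))) (value (next (-5) [(0,1), (11,1)] (value (next (-4) [(1,6), (5,9),
    (15,7)] (value (next 2 [(1,9), (5,3), (20,7)] (value (next 8 [(1,1), (11,1), (25,1)] (above
    [(0,1), (26,2)])) (above [(1,1), (15,1)]))) (value (next 4 [(1,1), (20,1)] (above [(0,1),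
    (21,1)])) (above [(1,1), (6,1), (10,1)])))) (above [(1,3), (5,6), (10,7)]))) (above [(1,3),
    (2,3), (5,2)]))),
    next (-1) [(0,1), (6,1)] (value (next (-6) [(0,1), (11,1)] (value (next 0 [(1,3), (5,3),
    (15,5)] (value (next 8 [(1,1), (6,1), (20,2)] (above [(0,3), (1,2)])) (above [(0,1),
    (16,1)]))) (value (next 2 [(1,9), (5,6), (15,13)] (above [(0,1), (16,1)])) (above [(1,6),
    (5,9), (10,13)])))) (value (next (-5) [(0,2), (1,1)] (value (next (-2) [(1,2), (5,1), (11,2)]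
    (value (next 6 [(1,2), (15,1), (20,3)] (above [(0,1), (21,2)])) (value (next 8 [(1,1), (15,1),
    (20,2)] (above [(0,1), (21,3)])) (above [(1,2), (6,1), (10,2)])))) (above [(1,3), (5,3),
    (10,5)]))) (value (next (-4) [(0,1), (11,1)] (value (next (-5) [(1,3), (5,9), (15,7)] (value
    (next 0 [(1,9), (5,6), (20,7)] (value (next 7 [(1,3), (6,3), (25,5)] (above [(0,1), (1,1)]))
    (above [(1,1), (15,1)]))) (value (next 2 [(1,9), (5,3), (20,8)] (value (next 8 [(1,3), (6,9),
    (25,10)] (above [(0,1), (26,2)])) (above [(0,1), (21,1)]))) (above [(1,1), (6,1), (10,1)]))))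
    (above [(1,6), (5,3), (10,7)]))) (above [(1,3), (2,6), (5,1)])))),
    next 0 [(0,1), (6,1)] (value (next (-6) [(0,3), (1,1)] (above [(1,1), (5,1), (10,2)])) (value
    (next (-5) [(0,1), (11,1)] (above [(1,3), (5,2), (10,5)])) (value (next (-4) [(0,1), (11,1)]
    (above [(1,3), (5,1), (10,4)])) (value (next (-3) [(0,1), (11,1)] (above [(1,1), (10,1)]))
    (above [(1,1), (2,3)])))))]

open SearchTree in
/-- The search trees for the maximal term `a₀ = -3` and `s₀ = 0, -1, …, -6`. -/
def searchTreesThreeNeg : List SearchTree := [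
    next 1 [(1,1), (6,3)] (value (next (-2) [(1,6), (6,5), (8,3)] (value (next 3 [(1,3), (15,2)]
    (value (next 0 [(0,1), (21,1)] (above [(1,2), (5,3), (16,2)])) (above [(0,1), (16,1)])))
    (value (next 2 [(1,3), (8,3), (15,1)] (value (next (-2) [(0,1), (21,1)] (value (next 2 [(1,3),
    (6,3), (21,2)] (above [(0,1), (26,2)])) (above [(1,1), (6,1), (20,1)]))) (above [(1,5), (5,5),
    (9,1)]))) (above [(1,3), (5,2), (10,1)])))) (value (next (-4) [(0,3), (5,1)] (value (next 5
    [(1,3), (6,6), (11,5)] (above [(0,1), (16,5)])) (value (next 3 [(1,6), (6,9), (11,7)] (above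
    [(0,1), (16,2)])) (above [(1,3), (5,1), (10,2)])))) (value (next (-3) [(0,3), (5,1)] (above
    [(1,1), (10,1)])) (value (next (-2) [(0,3), (5,1)] (above [(1,3), (6,1), (10,4)])) (value
    (next (-1) [(0,3), (5,1)] (above [(1,3), (6,2), (10,5)])) (value (next 0 [(0,3), (5,1)] (above
    [(1,1), (6,1), (10,2)])) (above [(0,1), (6,1)]))))))),
    next 2 [(1,3), (5,1), (6,6)] (value (next (-3) [(0,1), (11,1)] (value (next 4 [(1,4), (6,9),
    (11,6)] (above [(0,1), (16,4)])) (value (next 2 [(1,1), (11,1), (15,1)] (above [(0,1),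
    (16,1)])) (above [(1,3), (10,2)])))) (value (next (-2) [(0,1), (11,1)] (above [(1,6), (6,3),
    (10,7)])) (value (next (-1) [(0,1), (11,1)] (above [(1,3), (6,3), (10,5)])) (value (next 0
    [(0,1), (11,1)] (above [(1,6), (6,9), (10,13)])) (above [(0,1), (6,1)]))))),
    next 3 [(1,3), (5,2), (6,3)] (value (next (-1) [(0,1), (11,1)] (above [(1,3), (6,6), (10,7)]))
    (value (next 0 [(0,1), (11,1)] (above [(1,3), (6,9), (10,10)])) (above [(0,1), (6,1)]))),
    next 4 [(1,1), (5,1)] (above [(0,1), (6,1)]),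
    next 2 [(1,3), (2,3), (5,2)] (value (next 8 [(1,3), (6,9), (10,10)] (above [(0,1), (11,2)]))
    (above [(0,1), (6,1)])),
    next 0 [(1,3), (2,6), (5,1)] (value (next 7 [(1,3), (6,3), (10,5)] (above [(0,1), (1,1)]))
    (value (next 8 [(1,6), (6,9), (10,13)] (above [(0,1), (11,2)])) (above [(0,1), (6,1)]))),
    next (-3) [(1,1), (2,3)] (value (next 4 [(1,1), (10,1)] (above [(0,1), (11,1)])) (value (next
    6 [(1,3), (6,1), (10,4)] (above [(0,1), (11,2)])) (value (next 8 [(1,3), (6,2), (10,5)] (above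
    [(0,1), (11,3)])) (value (next 8 [(1,1), (6,1), (10,2)] (above [(0,3), (1,2)])) (above [(0,1),
    (6,1)])))))]

open SearchTree in
/-- The search trees for the maximal term `a₀ = 4` and `s₀ = 0, 1, …, 8`. -/
def searchTreesFourPos : List SearchTree := [
    next (-8) [(0,1), (6,1)] (value (next 2 [(1,3), (5,3), (10,8)] (above [(0,2), (6,1)])) (value
    (next 4 [(1,12), (5,9), (10,28)] (above [(0,4), (6,3)])) (value (next 5 [(1,2), (5,1), (10,4)]
    (above [(0,4), (6,3)])) (value (next 6 [(1,12), (5,3), (10,20)] (above [(0,4), (6,3)])) (value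
    (next 6 [(1,3), (10,4)] (above [(0,2), (6,1)])) (value (next 5 [(1,4), (6,1), (10,4)] (value
    (next 0 [(0,1), (16,1)] (above [(1,3), (10,3), (15,5)])) (above [(0,4), (6,1)]))) (value (next
    4 [(1,6), (6,3), (10,4)] (value (next (-2) [(0,1), (16,1)] (above [(1,1), (6,1), (15,2)]))
    (value (next (-1) [(0,1), (16,1)] (above [(1,2), (5,5), (10,4)])) (value (next 0 [(0,1),
    (16,1)] (above [(1,2), (5,6), (10,5)])) (above [(0,4), (6,1)]))))) (value (next 3 [(1,12),
    (6,9), (10,4)] (value (next (-4) [(0,1), (16,1)] (value (next 4 [(1,3), (6,4), (15,3)] (above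
    [(0,1), (21,4)])) (above [(1,1), (15,1)]))) (value (next (-3) [(0,1), (16,1)] (above [(1,9),
    (6,3), (15,13)])) (above [(1,8), (5,7), (8,4)])))) (value (next 1 [(1,1), (11,4)] (value (next
    (-2) [(1,8), (6,7), (13,4)] (value (next 3 [(1,3), (8,3), (20,2)] (value (next (-2) [(0,1),
    (26,1)] (above [(1,3), (6,6), (25,7)])) (value (next (-1) [(0,1), (26,1)] (above [(1,4),
    (5,8), (20,5)])) (value (contra [(0,8), (3,20), (18,23)]) (above [(0,1), (21,1)]))))) (value
    (next 2 [(1,3), (8,6), (20,1)] (value (next (-3) [(1,5), (2,2), (6,6)] (value (next 5 [(1,1),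
    (6,2), (15,1)] (above [(0,1), (31,4)])) (value (next 3 [(1,6), (25,3), (30,4)] (above [(0,1),
    (31,1)])) (above [(1,3), (25,2)])))) (above [(1,7), (5,7), (9,1)]))) (above [(1,3), (3,9),
    (15,1)])))) (above [(1,1), (5,1)]))) (above [(1,1), (6,4)])))))))))),
    next (-7) [(0,1), (6,1)] (value (next 1 [(1,9), (5,12), (10,25)] (above [(0,1), (11,1)]))
    (value (next 3 [(1,3), (5,3), (10,7)] (above [(0,1), (11,2)])) (value (next 4 [(1,9), (5,6),
    (10,17)] (above [(0,1), (11,2)])) (value (next 5 [(1,9), (5,3), (10,13)] (above [(0,1),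
    (11,2)])) (value (next 4 [(1,1), (10,1)] (value (next 0 [(0,1), (16,1)] (above [(1,9),
    (10,12), (15,16)])) (above [(0,1), (11,1)]))) (value (next 3 [(1,9), (6,3), (10,5)] (value
    (next (-2) [(0,1), (16,1)] (above [(1,3), (6,6), (15,7)])) (value (next (-1) [(0,1), (16,1)]
    (above [(1,1), (5,3), (10,2)])) (value (next 0 [(0,1), (16,1)] (above [(1,5), (5,19),
    (10,13)])) (above [(0,1), (11,1)]))))) (value (next 2 [(1,9), (6,6), (10,1)] (value (next (-3)
    [(1,5), (2,2), (6,6)] (value (next 5 [(1,1), (6,2), (15,1)] (above [(0,1), (21,4)])) (value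
    (next 3 [(1,9), (15,6), (20,8)] (above [(0,1), (21,1)])) (above [(1,3), (15,2)])))) (above
    [(1,7), (5,5), (8,1)]))) (above [(1,3), (5,1), (6,9)])))))))),
    next (-6) [(0,1), (6,1)] (value (next 0 [(1,3), (5,6), (10,10)] (value (next 8 [(1,1), (6,1),
    (15,2)] (value (next 0 [(0,4), (5,1)] (above [(1,3), (6,3), (20,8)])) (above [(0,4), (1,1)])))
    (above [(0,1), (11,1)]))) (value (next 2 [(1,6), (5,9), (10,16)] (above [(0,1), (11,1)]))
    (value (next 4 [(1,1), (5,1), (10,2)] (above [(0,1), (11,2)])) (value (next 4 [(1,6), (5,3),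
    (10,8)] (above [(0,1), (11,1)])) (value (next 3 [(1,3), (10,2)] (value (next (-1) [(0,1),
    (16,1)] (above [(1,2), (10,3), (15,4)])) (above [(1,2), (4,1), (5,2)]))) (above [(1,3), (5,2),
    (6,6)])))))),
    next (-5) [(0,1), (6,1)] (value (next (-1) [(1,3), (5,12), (10,17)] (value (next 8 [(1,12),
    (6,9), (15,19)] (above [(0,1), (16,1)])) (value (next 7 [(1,3), (6,3), (15,5)] (value (next
    (-1) [(0,4), (5,1)] (above [(1,3), (6,4), (16,7)])) (value (next 0 [(0,4), (5,1)] (above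
    [(1,3), (6,3), (20,8)])) (above [(0,4), (1,1)])))) (above [(0,1), (11,1)])))) (value (next 3
    [(1,3), (5,9), (10,13)] (above [(0,1), (11,2)])) (above [(1,1), (5,1), (6,1)]))),
    next (-4) [(0,1), (6,1)] (above [(1,3), (5,4)]),
    next (-3) [(0,1), (6,1)] (value (next (-8) [(0,1), (11,1)] (value (next (-2) [(1,3), (5,3),
    (15,5)] (value (next 9 [(1,2), (6,1), (20,4)] (above [(0,1), (21,3)])) (value (next 11
    [(1,12), (6,9), (20,28)] (above [(0,1), (21,4)])) (value (next 13 [(1,5), (5,3), (11,8)]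
    (above [(0,4), (1,5)])) (above [(0,1), (16,1)]))))) (value (next 1 [(1,12), (5,9), (15,19)]
    (value (next 10 [(1,3), (11,3), (20,2)] (above [(0,1), (21,2)])) (above [(0,1), (16,1)])))
    (value (next 3 [(1,2), (5,1), (15,3)] (above [(0,1), (16,1)])) (above [(1,3), (5,12),
    (10,17)]))))) (above [(1,1), (2,1), (5,1)])),
    next (-2) [(0,1), (6,1)] (value (next (-8) [(0,1), (11,1)] (value (next 0 [(1,1), (5,1),
    (15,2)] (value (next 11 [(1,3), (6,3), (20,8)] (above [(0,4), (1,3)])) (above [(0,1),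
    (16,1)]))) (value (next 2 [(1,12), (5,9), (15,22)] (above [(0,1), (16,1)])) (above [(1,3),
    (5,6), (10,10)])))) (value (next (-7) [(0,1), (11,1)] (value (next (-3) [(1,9), (5,12),
    (15,17)] (value (next 8 [(1,2), (15,1), (20,4)] (above [(0,1), (21,3)])) (value (next 9
    [(1,3), (15,3), (20,8)] (above [(0,1), (21,3)])) (above [(1,3), (10,6), (15,5)])))) (above
    [(1,6), (5,9), (10,16)]))) (value (next (-6) [(0,2), (1,1)] (above [(1,1), (5,1), (10,2)]))
    (above [(1,3), (2,6), (5,2)])))),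
    next (-1) [(0,1), (6,1)] (value (next (-8) [(0,1), (11,1)] (value (next 1 [(1,3), (5,3),
    (15,7)] (above [(0,1), (16,1)])) (above [(1,9), (5,12), (10,25)]))) (value (next (-7) [(0,3),
    (1,1)] (above [(1,3), (5,3), (10,7)])) (value (next (-6) [(0,1), (11,1)] (above [(1,9), (5,6),
    (10,17)])) (value (next (-5) [(0,1), (11,1)] (above [(1,9), (5,3), (10,13)])) (above [(1,3),
    (2,9), (5,1)]))))),
    next 0 [(0,1), (6,1)] (value (next (-8) [(0,4), (1,1)] (above [(1,3), (5,3), (10,8)])) (value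
    (next (-7) [(0,1), (11,1)] (above [(1,12), (5,9), (10,28)])) (value (next (-6) [(0,1), (11,1)]
    (above [(1,2), (5,1), (10,4)])) (value (next (-5) [(0,1), (11,1)] (above [(1,12), (5,3),
    (10,20)])) (value (next (-4) [(0,1), (11,1)] (above [(1,3), (10,4)])) (above [(1,1),
    (2,4)]))))))]

open SearchTree in
/-- The search trees for the maximal term `a₀ = -4` and `s₀ = 0, -1, …, -8`. -/
def searchTreesFourNeg : List SearchTree := [
    next 1 [(1,1), (6,4)] (value (next (-2) [(1,8), (6,7), (8,4)] (value (next 3 [(1,3), (8,3),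
    (15,2)] (value (next (-2) [(0,1), (21,1)] (above [(1,3), (6,6), (20,7)])) (value (next (-1)
    [(0,1), (21,1)] (above [(1,4), (5,8), (16,5)])) (value (contra [(0,8), (3,20), (14,23)])
    (above [(0,1), (16,1)]))))) (value (next 2 [(1,3), (8,6), (15,1)] (value (next (-3) [(1,5),
    (2,2), (6,6)] (value (next 5 [(1,1), (6,2), (15,1)] (above [(0,1), (26,4)])) (value (next 3
    [(1,6), (21,3), (25,4)] (above [(0,1), (26,1)])) (above [(1,3), (20,2)])))) (above [(1,7),
    (5,7), (9,1)]))) (above [(1,3), (3,9), (10,1)])))) (value (next (-5) [(1,4), (6,3), (8,4)]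
    (value (next 9 [(1,2), (6,5), (11,4)] (above [(0,1), (16,8)])) (value (next 5 [(1,2), (6,4),
    (11,3)] (above [(0,1), (16,3)])) (value (next 4 [(1,6), (5,3), (15,8)] (above [(0,1),
    (16,1)])) (above [(1,6), (5,3), (10,4)]))))) (value (next (-5) [(0,4), (5,1)] (value (next 5
    [(1,12), (6,20), (11,17)] (above [(0,1), (16,5)])) (value (next 4 [(1,12), (11,9), (15,16)]
    (above [(0,1), (16,3)])) (above [(1,4), (5,1), (10,4)])))) (value (next (-4) [(0,4), (5,1)]
    (above [(1,3), (10,4)])) (value (next (-3) [(0,4), (5,1)] (above [(1,12), (6,3), (10,20)]))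
    (value (next (-2) [(0,4), (5,1)] (above [(1,2), (6,1), (10,4)])) (value (next (-1) [(0,4),
    (5,1)] (above [(1,12), (6,9), (10,28)])) (value (next 0 [(0,4), (5,1)] (above [(1,3), (6,3),
    (10,8)])) (above [(0,1), (6,1)]))))))))),
    next 2 [(1,3), (5,1), (6,9)] (value (next (-3) [(1,7), (6,4), (8,5)] (value (next 4 [(1,5),
    (6,11), (11,7)] (above [(0,1), (16,2)])) (value (next 3 [(1,3), (5,3), (15,4)] (value (next 0
    [(0,1), (21,1)] (above [(1,7), (5,13), (16,5)])) (above [(0,1), (16,1)]))) (above [(1,9),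
    (5,3), (10,5)])))) (value (next (-4) [(0,1), (11,1)] (value (next 4 [(1,9), (6,16), (11,12)]
    (above [(0,1), (16,4)])) (above [(1,1), (10,1)]))) (value (next (-3) [(0,1), (11,1)] (above
    [(1,9), (6,3), (10,13)])) (value (next (-2) [(0,1), (11,1)] (above [(1,9), (6,6), (10,17)]))
    (value (next (-1) [(0,1), (11,1)] (above [(1,3), (6,3), (10,7)])) (value (next 0 [(0,1),
    (11,1)] (above [(1,9), (6,12), (10,25)])) (above [(0,1), (6,1)]))))))),
    next 3 [(1,3), (5,2), (6,6)] (value (next (-3) [(0,1), (11,1)] (value (next 4 [(1,3), (11,6),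
    (15,7)] (above [(0,1), (16,4)])) (above [(1,6), (6,3), (10,8)]))) (value (next (-2) [(0,1),
    (11,1)] (above [(1,1), (6,1), (10,2)])) (value (next (-1) [(0,1), (11,1)] (above [(1,6),
    (6,9), (10,16)])) (value (next 0 [(0,1), (11,1)] (above [(1,3), (6,6), (10,10)])) (above
    [(0,1), (6,1)]))))),
    next 5 [(1,1), (5,1), (6,1)] (value (next 0 [(0,1), (11,1)] (above [(1,3), (6,12), (10,17)]))
    (above [(0,1), (6,1)])),
    next 6 [(1,3), (5,4)] (above [(0,1), (6,2)]),
    next 3 [(1,1), (2,1), (5,1)] (value (next 11 [(1,3), (6,12), (10,17)] (above [(0,1), (11,3)]))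
    (above [(0,1), (6,1)])),
    next 1 [(1,3), (2,6), (5,2)] (value (next 10 [(1,6), (6,9), (10,16)] (above [(0,1), (11,3)]))
    (value (next 10 [(1,3), (6,6), (10,10)] (above [(0,1), (11,2)])) (above [(0,1), (6,1)]))),
    next (-1) [(1,3), (2,9), (5,1)] (value (next 9 [(1,9), (6,6), (10,17)] (above [(0,1),
    (11,3)])) (value (next 10 [(1,3), (6,3), (10,7)] (above [(0,1), (1,1)])) (value (next 10
    [(1,9), (6,12), (10,25)] (above [(0,1), (11,2)])) (above [(0,1), (6,1)])))),
    next (-4) [(1,1), (2,4)] (value (next 6 [(1,3), (10,4)] (above [(0,1), (11,2)])) (value (next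
    8 [(1,12), (6,3), (10,20)] (above [(0,1), (11,3)])) (value (next 9 [(1,2), (6,1), (10,4)]
    (above [(0,1), (11,3)])) (value (next 11 [(1,12), (6,9), (10,28)] (above [(0,1), (11,4)]))
    (value (next 11 [(1,3), (6,3), (10,8)] (above [(0,4), (1,3)])) (above [(0,1), (6,1)]))))))]

open SearchTree in
/-- The search trees for the maximal term `a₀ = 5` and `s₀ = 0, 1, …, 10`. -/
def searchTreesFivePos : List SearchTree := [
    next (-10) [(0,1), (6,1)] (value (next 3 [(1,3), (5,3), (10,10)] (above [(0,5), (6,3)]))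
    (value (next 5 [(1,5), (5,4), (10,15)] (above [(0,5), (6,4)])) (value (next 6 [(1,15), (5,9),
    (10,40)] (above [(0,5), (6,4)])) (value (next 7 [(1,15), (5,6), (10,35)] (above [(0,5),
    (6,4)])) (value (next 7 [(1,5), (5,1), (10,10)] (above [(0,5), (6,3)])) (value (next 7 [(1,3),
    (10,5)] (above [(0,5), (6,2)])) (value (next 7 [(1,15), (6,3), (10,20)] (above [(0,5),
    (6,1)])) (value (next 6 [(1,5), (6,2), (10,5)] (value (next (-1) [(0,1), (16,1)] (above
    [(1,1), (6,2), (15,4)])) (value (next 0 [(0,1), (16,1)] (above [(1,3), (10,3), (15,7)]))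
    (above [(0,5), (6,1)])))) (value (next 4 [(1,15), (6,9), (10,10)] (value (next (-4) [(0,1),
    (16,1)] (value (next 4 [(1,9), (11,15), (20,22)] (above [(0,1), (21,4)])) (above [(1,9),
    (6,3), (15,14)]))) (value (next (-3) [(0,1), (16,1)] (above [(1,9), (6,6), (15,19)])) (value
    (next (-2) [(0,1), (16,1)] (above [(1,3), (6,3), (15,8)])) (value (next (-1) [(0,1), (16,1)]
    (above [(1,9), (6,12), (15,29)])) (above [(1,5), (5,4), (8,5)])))))) (value (next 3 [(1,15),
    (6,12), (10,5)] (value (next (-6) [(0,1), (16,1)] (value (contra [(0,11), (4,35), (9,39)])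
    (value (next 7 [(1,15), (6,25), (15,17)] (above [(0,1), (21,6)])) (value (next 5 [(1,15),
    (15,9), (20,20)] (above [(0,1), (21,3)])) (above [(1,1), (9,1), (15,1)]))))) (value (next (-5)
    [(0,1), (16,1)] (value (next 6 [(1,1), (10,5), (15,5)] (above [(0,1), (21,6)])) (above [(1,3),
    (15,4)]))) (above [(1,10), (5,9), (8,5)])))) (value (next 1 [(1,1), (11,5)] (value (next (-2)
    [(1,10), (6,9), (13,5)] (value (next 3 [(1,9), (9,2), (20,6)] (value (next (-3) [(1,6),
    (6,13), (11,8)] (value (next 4 [(1,5), (25,4), (30,5)] (above [(0,1), (31,3)])) (above [(1,6),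
    (6,3), (25,8)]))) (value (next (-3) [(0,1), (26,1)] (above [(1,1), (6,1), (25,2)])) (value
    (contra [(0,2), (3,5), (18,6)]) (above [(1,5), (2,2), (5,6)]))))) (value (next 2 [(1,3),
    (9,1), (20,1)] (value (next (-3) [(1,2), (9,7), (10,4)] (value (next 5 [(1,1), (6,2), (15,1)]
    (above [(0,1), (31,2)])) (value (next 3 [(1,3), (5,3), (30,4)] (value (next (-1) [(0,1),
    (36,1)] (above [(1,2), (5,3), (30,1)])) (above [(1,3), (5,3), (9,1)]))) (above [(1,6), (9,3),
    (25,4)])))) (above [(1,9), (5,9), (9,1)]))) (above [(1,9), (4,4), (15,3)])))) (above [(1,1),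
    (5,1)]))) (above [(1,1), (6,5)])))))))))))),
    next (-9) [(0,1), (6,1)] (value (next 2 [(1,12), (5,15), (10,41)] (above [(0,1), (11,2)]))
    (value (next 4 [(1,1), (5,1), (10,3)] (above [(0,1), (11,3)])) (value (next 5 [(1,12), (5,9),
    (10,31)] (above [(0,1), (11,3)])) (value (next 6 [(1,6), (5,3), (10,13)] (above [(0,1),
    (11,3)])) (value (next 6 [(1,4), (5,1), (10,7)] (above [(0,1), (11,2)])) (value (next 6
    [(1,3), (10,4)] (above [(0,1), (11,1)])) (value (next 5 [(1,1), (10,1), (11,1)] (value (next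
    (-1) [(0,1), (16,1)] (above [(1,1), (10,1), (15,2)])) (value (next 0 [(0,1), (16,1)] (above
    [(1,11), (5,29), (10,21)])) (above [(0,1), (11,1)])))) (value (next 3 [(1,2), (6,1), (10,1)]
    (value (next (-3) [(1,6), (6,13), (11,8)] (value (next 4 [(1,3), (11,6), (20,7)] (above
    [(0,1), (21,3)])) (above [(1,6), (6,3), (15,8)]))) (value (next (-3) [(0,1), (16,1)] (above
    [(1,1), (6,1), (15,2)])) (value (next (-2) [(0,1), (16,1)] (above [(1,6), (6,9), (15,16)]))
    (above [(1,3), (5,2), (8,2)]))))) (value (next 2 [(1,6), (4,9), (10,2)] (value (next (-3)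
    [(1,2), (9,7), (10,4)] (value (next 5 [(1,1), (6,2), (15,1)] (above [(0,1), (21,2)])) (value
    (next 3 [(1,3), (5,3), (20,4)] (value (next (-1) [(0,1), (26,1)] (above [(1,3), (20,3),
    (25,4)])) (above [(1,3), (5,3), (9,1)]))) (above [(1,6), (9,3), (15,4)])))) (above [(1,9),
    (5,7), (8,1)]))) (above [(1,3), (5,1), (6,12)])))))))))),
    next (-8) [(0,1), (6,1)] (value (next 1 [(1,9), (5,15), (10,34)] (above [(0,1), (11,1)]))
    (value (next 3 [(1,9), (5,12), (10,29)] (above [(0,1), (11,2)])) (value (next 4 [(1,3), (5,3),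
    (10,8)] (above [(0,1), (11,2)])) (value (next 5 [(1,9), (5,6), (10,19)] (above [(0,1),
    (11,2)])) (value (next 5 [(1,9), (5,3), (10,14)] (above [(0,1), (11,1)])) (value (next 4
    [(1,1), (10,1)] (value (next (-1) [(0,1), (16,1)] (above [(1,9), (10,12), (15,20)])) (value
    (next 0 [(0,1), (16,1)] (above [(1,9), (5,25), (10,15)])) (above [(0,1), (11,1)])))) (value
    (next 3 [(1,9), (6,3), (10,4)] (value (next (-3) [(0,1), (16,1)] (value (next 4 [(1,9),
    (15,15), (20,19)] (above [(0,1), (21,4)])) (above [(1,3), (6,6), (15,7)]))) (above [(1,2),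
    (4,1), (5,2)]))) (above [(1,3), (5,2), (6,9)])))))))),
    next (-7) [(0,1), (6,1)] (value (next 0 [(1,6), (5,15), (10,29)] (value (next 10 [(1,3),
    (6,3), (15,7)] (value (next 0 [(0,5), (5,1)] (above [(1,1), (10,1), (20,1)])) (above [(0,5),
    (1,1)]))) (above [(0,1), (11,1)]))) (value (next 3 [(1,1), (5,2), (10,4)] (above [(0,1),
    (11,2)])) (value (next 4 [(1,6), (5,9), (10,19)] (above [(0,1), (11,2)])) (value (next 5
    [(1,3), (5,3), (10,7)] (above [(0,1), (11,2)])) (above [(1,1), (5,1), (6,2)]))))),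
    next (-6) [(0,1), (6,1)] (value (next 0 [(1,3), (5,15), (10,26)] (value (next 8 [(1,1), (6,1),
    (15,2)] (value (next (-2) [(0,5), (5,1)] (above [(1,1), (6,1), (16,2)])) (value (next (-1)
    [(0,5), (5,1)] (above [(1,4), (6,5), (16,9)])) (above [(1,3), (10,15), (15,20)])))) (above
    [(0,1), (11,1)]))) (value (next 5 [(1,1), (5,4), (10,7)] (above [(0,1), (11,4)])) (above
    [(1,3), (5,4), (6,3)]))),
    next (-5) [(0,1), (6,1)] (above [(1,3), (5,5)]),
    next (-4) [(0,1), (6,1)] (value (next (-10) [(0,1), (11,1)] (value (next (-2) [(1,1), (5,1),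
    (15,2)] (value (next 12 [(1,3), (15,9), (20,20)] (above [(0,1), (21,4)])) (value (next 14
    [(1,5), (11,4), (20,7)] (above [(0,1), (21,5)])) (above [(1,3), (10,15), (15,20)])))) (value
    (next 0 [(1,15), (5,12), (15,29)] (value (next 13 [(1,1), (15,4), (20,8)] (above [(0,1),
    (1,1)])) (above [(1,1), (10,4), (15,5)]))) (above [(1,3), (5,15), (10,26)])))) (above [(1,3),
    (2,3), (5,4)])),
    next (-3) [(0,1), (6,1)] (value (next (-10) [(0,1), (11,1)] (value (next (-1) [(1,3), (5,3),
    (15,7)] (value (next 13 [(1,1), (15,2), (20,5)] (above [(0,1), (21,4)])) (value (next 14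
    [(1,1), (11,1), (20,1)] (above [(0,5), (1,4)])) (above [(0,1), (16,1)])))) (value (next 1
    [(1,5), (5,4), (15,11)] (value (next 13 [(1,2), (15,5), (20,11)] (above [(0,1), (21,3)]))
    (above [(0,1), (16,1)]))) (above [(1,6), (5,15), (10,29)])))) (value (next (-9) [(0,1),
    (11,1)] (above [(1,1), (5,2), (10,4)])) (above [(1,1), (2,2), (5,1)]))),
    next (-2) [(0,1), (6,1)] (value (next (-10) [(0,1), (11,1)] (value (next 0 [(1,3), (5,3),
    (15,8)] (value (next 14 [(1,3), (6,3), (20,10)] (above [(0,5), (1,4)])) (above [(0,1),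
    (16,1)]))) (above [(1,9), (5,15), (10,34)]))) (value (next (-9) [(0,1), (11,1)] (above [(1,9),
    (5,12), (10,29)])) (value (next (-8) [(0,3), (1,1)] (above [(1,3), (5,3), (10,8)])) (value
    (next (-7) [(0,1), (11,1)] (above [(1,9), (5,6), (10,19)])) (above [(1,3), (2,9), (5,2)]))))),
    next (-1) [(0,1), (6,1)] (value (next (-10) [(0,1), (11,1)] (above [(1,12), (5,15), (10,41)]))
    (value (next (-9) [(0,4), (1,1)] (above [(1,1), (5,1), (10,3)])) (value (next (-8) [(0,1),
    (11,1)] (above [(1,12), (5,9), (10,31)])) (value (next (-7) [(0,1), (11,1)] (above [(1,6),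
    (5,3), (10,13)])) (value (next (-6) [(0,1), (11,1)] (above [(1,4), (5,1), (10,7)])) (above
    [(1,3), (2,12), (5,1)])))))),
    next 0 [(0,1), (6,1)] (value (next (-10) [(0,5), (1,1)] (above [(1,3), (5,3), (10,10)]))
    (value (next (-9) [(0,1), (11,1)] (above [(1,5), (5,4), (10,15)])) (value (next (-8) [(0,1),
    (11,1)] (above [(1,15), (5,9), (10,40)])) (value (next (-7) [(0,1), (11,1)] (above [(1,15),
    (5,6), (10,35)])) (value (next (-6) [(0,1), (11,1)] (above [(1,5), (5,1), (10,10)])) (value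
    (next (-5) [(0,1), (11,1)] (above [(1,3), (10,5)])) (above [(1,1), (2,5)])))))))]

open SearchTree in
/-- The search trees for the maximal term `a₀ = -5` and `s₀ = 0, -1, …, -10`. -/
def searchTreesFiveNeg : List SearchTree := [
    next 1 [(1,1), (6,5)] (value (next (-2) [(1,10), (6,9), (8,5)] (value (next 3 [(1,9), (9,2),
    (15,6)] (value (next (-3) [(1,6), (6,13), (11,8)] (value (next 4 [(1,5), (21,4), (25,5)]
    (above [(0,1), (26,3)])) (above [(1,6), (6,3), (20,8)]))) (value (next (-3) [(0,1), (21,1)]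
    (above [(1,1), (6,1), (20,2)])) (value (contra [(0,2), (3,5), (14,6)]) (above [(1,5), (2,2),
    (5,6)]))))) (value (next 2 [(1,3), (9,1), (15,1)] (value (next (-3) [(1,2), (9,7), (10,4)]
    (value (next 5 [(1,1), (6,2), (15,1)] (above [(0,1), (26,2)])) (value (next 3 [(1,3), (5,3),
    (25,4)] (value (next (-1) [(0,1), (31,1)] (above [(1,2), (5,3), (26,1)])) (above [(1,3),
    (5,3), (9,1)]))) (above [(1,6), (9,3), (20,4)])))) (above [(1,9), (5,9), (9,1)]))) (above
    [(1,9), (4,4), (10,3)])))) (value (next (-5) [(1,5), (6,4), (8,5)] (value (next 9 [(1,10),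
    (6,25), (11,19)] (above [(0,1), (16,6)])) (value (next 6 [(1,5), (6,10), (11,7)] (above
    [(0,1), (16,2)])) (value (next 4 [(1,1), (15,1)] (value (next (-1) [(0,1), (21,1)] (above
    [(1,1), (11,2), (16,2)])) (value (next 0 [(0,1), (21,1)] (above [(1,3), (5,5), (16,3)]))
    (above [(0,1), (16,1)])))) (above [(1,15), (5,9), (10,10)]))))) (value (next (-7) [(0,5),
    (5,1)] (value (next 11 [(1,15), (6,35), (11,29)] (above [(0,1), (16,11)])) (value (next 8
    [(1,5), (6,10), (11,8)] (above [(0,1), (16,7)])) (value (next 5 [(1,15), (11,9), (15,25)]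
    (above [(0,1), (16,3)])) (value (next 5 [(1,3), (5,3), (15,7)] (above [(0,1), (16,2)])) (above
    [(1,5), (5,2), (10,5)])))))) (value (next (-6) [(0,5), (5,1)] (value (next 4 [(1,1), (11,1),
    (15,2)] (above [(0,1), (16,4)])) (value (next 5 [(1,1), (5,4), (15,7)] (above [(0,1),
    (16,4)])) (above [(1,6), (4,1), (10,8)])))) (value (next (-5) [(0,5), (5,1)] (above [(1,3),
    (10,5)])) (value (next (-4) [(0,5), (5,1)] (above [(1,5), (6,1), (10,10)])) (value (next (-3)
    [(0,5), (5,1)] (above [(1,15), (6,6), (10,35)])) (value (next (-2) [(0,5), (5,1)] (above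
    [(1,15), (6,9), (10,40)])) (value (next (-1) [(0,5), (5,1)] (above [(1,5), (6,4), (10,15)]))
    (value (next 0 [(0,5), (5,1)] (above [(1,3), (6,3), (10,10)])) (above [(0,1),
    (6,1)]))))))))))),
    next 2 [(0,6), (1,3), (5,1)] (value (next (-3) [(1,3), (6,2), (8,2)] (value (next 4 [(1,6),
    (5,3), (15,8)] (value (next 0 [(0,1), (21,1)] (above [(1,4), (16,5), (20,7)])) (above [(0,1),
    (16,1)]))) (value (next 3 [(1,3), (15,2)] (value (next (-2) [(0,1), (21,1)] (above [(1,4),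
    (16,3), (20,5)])) (above [(1,7), (5,7), (9,2)]))) (above [(1,2), (5,1), (10,1)])))) (value
    (next (-6) [(0,1), (11,1)] (value (contra [(0,11), (4,35), (9,39)]) (value (next 7 [(1,11),
    (6,24), (11,17)] (above [(0,1), (16,6)])) (value (next 5 [(1,12), (11,9), (15,19)] (above
    [(0,1), (16,3)])) (above [(1,6), (4,1), (10,6)]))))) (value (next (-5) [(0,1), (11,1)] (value
    (next 4 [(1,12), (11,15), (15,25)] (above [(0,1), (16,4)])) (above [(1,3), (10,4)]))) (value
    (next (-4) [(0,1), (11,1)] (above [(1,4), (6,1), (10,7)])) (value (next (-3) [(0,1), (11,1)]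
    (above [(1,6), (6,3), (10,13)])) (value (next (-2) [(0,1), (11,1)] (above [(1,12), (6,9),
    (10,31)])) (value (next (-1) [(0,1), (11,1)] (above [(1,1), (6,1), (10,3)])) (value (next 0
    [(0,1), (11,1)] (above [(1,12), (6,15), (10,41)])) (above [(0,1), (6,1)]))))))))),
    next 3 [(1,3), (5,2), (6,9)] (value (next (-4) [(1,2), (6,3), (11,9)] (value (next 5 [(1,9),
    (6,20), (11,12)] (above [(0,1), (16,4)])) (above [(1,1), (10,1)]))) (value (next (-4) [(0,1),
    (11,1)] (value (next 4 [(1,9), (11,15), (15,22)] (above [(0,1), (16,4)])) (above [(1,9),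
    (6,3), (10,14)]))) (value (next (-3) [(0,1), (11,1)] (above [(1,9), (6,6), (10,19)])) (value
    (next (-2) [(0,1), (11,1)] (above [(1,3), (6,3), (10,8)])) (value (next (-1) [(0,1), (11,1)]
    (above [(1,9), (6,12), (10,29)])) (value (next 0 [(0,1), (11,1)] (above [(1,9), (6,15),
    (10,34)])) (above [(0,1), (6,1)]))))))),
    next 5 [(1,1), (5,1), (6,2)] (value (next (-2) [(0,1), (11,1)] (above [(1,6), (6,9),
    (10,19)])) (value (next (-1) [(0,1), (11,1)] (above [(1,1), (6,2), (10,4)])) (value (next 0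
    [(0,1), (11,1)] (above [(1,6), (6,15), (10,29)])) (above [(0,1), (6,1)])))),
    next 6 [(1,3), (5,4), (6,3)] (value (next 0 [(0,1), (11,1)] (above [(1,3), (6,15), (10,26)]))
    (above [(0,1), (6,1)])),
    next 7 [(1,3), (5,5)] (above [(0,1), (6,2)]),
    next 5 [(1,3), (2,3), (5,4)] (above [(0,1), (6,1)]),
    next 2 [(1,1), (2,2), (5,1)] (value (next 12 [(1,1), (6,2), (10,4)] (above [(0,1), (11,3)]))
    (value (next 12 [(1,6), (6,15), (10,29)] (above [(0,1), (11,2)])) (above [(0,1), (6,1)]))),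
    next 0 [(1,3), (2,9), (5,2)] (value (next 11 [(1,3), (6,3), (10,8)] (above [(0,1), (1,1)]))
    (value (next 12 [(1,9), (6,12), (10,29)] (above [(0,1), (11,3)])) (value (next 12 [(1,9),
    (6,15), (10,34)] (above [(0,1), (11,2)])) (above [(0,1), (6,1)])))),
    next (-2) [(1,3), (2,12), (5,1)] (value (next 10 [(1,6), (6,3), (10,13)] (above [(0,1),
    (11,3)])) (value (next 12 [(1,12), (6,9), (10,31)] (above [(0,1), (11,4)])) (value (next 12
    [(1,1), (6,1), (10,3)] (above [(0,4), (1,3)])) (value (next 13 [(1,12), (6,15), (10,41)]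
    (above [(0,1), (11,3)])) (above [(0,1), (6,1)]))))),
    next (-5) [(1,1), (2,5)] (value (next 7 [(1,3), (10,5)] (above [(0,1), (11,2)])) (value (next
    9 [(1,5), (6,1), (10,10)] (above [(0,1), (11,3)])) (value (next 11 [(1,15), (6,6), (10,35)]
    (above [(0,1), (11,4)])) (value (next 12 [(1,15), (6,9), (10,40)] (above [(0,1), (11,4)]))
    (value (next 13 [(1,5), (6,4), (10,15)] (above [(0,1), (11,4)])) (value (next 14 [(1,3),
    (6,3), (10,10)] (above [(0,5), (1,4)])) (above [(0,1), (6,1)])))))))]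

open SearchTree in
/-- The search trees for a term `a₀ ≥ 6` of maximal modulus and `s₀ = 0, 1, 2`. -/
def searchTreesLargePos : List SearchTree := [
    next (-2) [(1,1), (4,1)] (value (next 4 [(1,1), (6,1), (11,2)] (value (next (-5) [(1,1),
    (6,2), (11,1), (18,2)] (value (next 5 [(1,1), (20,1), (21,5)] (above [(0,3), (11,24), (16,18),
    (22,16)])) (above [(1,3), (15,3), (17,4)]))) (value (next (-9) [(1,2), (6,5), (9,2), (11,3)]
    (value (contra [(0,7), (4,9), (17,16), (20,6)]) (value (next 11 [(1,30), (6,48), (19,37),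
    (20,19)] (value (contra [(2,19), (4,130), (9,208), (22,116)]) (value (next (-15) [(1,4),
    (2,9), (24,13), (27,20)] (value (contra [(0,3), (8,3), (27,6), (30,7)]) (above [(1,8), (2,17),
    (11,60), (24,69)]))) (value (contra [(0,8), (3,13), (22,21), (26,91)]) (above [(1,1), (2,1),
    (8,1), (19,2)]))))) (value (next 8 [(1,3), (3,3), (19,3), (22,7)] (value (contra [(2,3),
    (4,6), (24,18), (25,8)]) (value (next (-1) [(0,42), (6,75), (24,9), (27,175)] (above [(1,3),
    (5,6), (7,1), (16,4)])) (value (next (-13) [(1,5), (6,8), (9,1), (15,3)] (value (contra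
    [(0,72), (4,39), (27,111), (30,182)]) (value (next 14 [(1,5), (3,1), (6,6), (29,3)] (above
    [(0,3), (5,6), (32,20), (33,6)])) (value (contra [(1,30), (3,21), (9,39), (30,161)]) (above
    [(1,3), (4,3), (24,3), (27,10)]))))) (above [(1,1), (5,2), (16,1), (22,1)]))))) (value (next 6
    [(1,1), (3,1), (19,1), (22,2)] (above [(0,3), (5,9), (10,3), (22,13)])) (above [(1,3), (15,3),
    (16,3), (17,4)])))))) (value (contra [(0,1), (3,3), (12,4)]) (above [(1,2), (4,1), (8,2),
    (9,2)]))))) (value (next 3 [(1,6), (6,5), (10,1), (12,2)] (value (next (-6) [(1,2), (2,1),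
    (6,3), (9,2)] (value (contra [(0,2), (4,7), (9,9), (21,7)]) (value (next 7 [(1,5), (3,1),
    (6,11), (11,8)] (value (next (-7) [(0,15), (6,48), (11,18), (27,62)] (value (contra [(1,1),
    (3,4), (14,13), (19,11)]) (above [(1,3), (4,3), (24,3), (27,7)]))) (value (next (-11) [(1,13),
    (2,3), (6,16), (28,53)] (value (next 15 [(1,108), (2,29), (6,204), (21,125)] (above [(0,12),
    (2,41), (21,65), (32,172)])) (value (next 12 [(1,3), (3,3), (29,3), (32,10)] (value (contra
    [(2,6), (4,3), (8,9), (35,34)]) (value (contra [(0,39), (3,21), (24,60), (35,119)]) (above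
    [(1,27), (2,10), (5,37), (32,42)])))) (value (contra [(1,6), (3,9), (19,3), (30,25)]) (above
    [(1,44), (5,81), (8,8), (16,53)]))))) (value (next (-13) [(1,1), (2,1), (9,1), (20,2)] (value
    (contra [(0,2), (8,7), (16,7), (19,9)]) (value (contra [(0,9), (8,12), (27,21), (30,16)])
    (above [(1,5), (5,9), (8,1), (24,6)])))) (above [(1,3), (2,2), (8,3), (11,5)]))))) (value
    (next 5 [(1,3), (5,3), (20,6), (22,7)] (value (next 0 [(0,2), (6,3), (10,1), (27,5)] (above
    [(1,4), (5,6), (8,1), (16,4)])) (value (next (-8) [(1,5), (2,1), (6,6), (9,2)] (value (next 10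
    [(1,4), (6,7), (7,1), (21,4)] (value (contra [(2,9), (4,12), (18,6), (35,38)]) (value (contra
    [(0,6), (9,9), (18,15), (35,19)]) (above [(1,1), (7,1), (11,2), (32,2)])))) (value (next 8
    [(1,3), (3,3), (29,3), (32,7)] (above [(0,1), (5,2), (32,4), (33,1)])) (value (contra [(1,5),
    (3,6), (13,4), (30,16)]) (above [(1,1), (4,1), (24,1), (27,2)]))))) (value (next (-9) [(1,1),
    (2,1), (10,2), (27,2)] (value (next 12 [(1,1), (10,6), (15,5), (33,4)] (above [(0,13), (2,28),
    (15,54), (32,138)])) (above [(1,1), (5,2), (16,1)]))) (above [(1,6), (5,8), (8,5), (9,1)])))))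
    (above [(1,1), (9,2), (15,1), (17,1)]))))) (value (next (-8) [(1,1), (2,1), (9,1), (10,2)]
    (value (contra [(0,1), (4,2), (17,3), (21,2)]) (value (next 10 [(1,48), (3,13), (6,84),
    (19,62)] (value (contra [(0,13), (4,10), (9,50), (22,53)]) (value (next (-15) [(1,1), (2,1),
    (9,1), (20,2)] (value (contra [(0,1), (14,3), (27,4), (30,1)]) (value (contra [(0,2), (14,7),
    (27,9), (31,7)]) (above [(1,92), (4,37), (11,253), (24,235)])))) (value (contra [(0,1), (9,3),
    (22,4), (26,3)]) (above [(1,1), (2,1), (8,1), (19,2)]))))) (value (next 7 [(1,1), (3,1),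
    (15,1), (22,2)] (value (contra [(2,3), (4,6), (24,12), (25,8)]) (value (next (-3) [(0,1),
    (6,2), (27,4), (28,1)] (above [(1,1), (8,1), (24,1), (26,8)])) (value (next (-12) [(1,5),
    (2,1), (6,6), (13,5)] (value (next 15 [(1,6), (3,1), (6,8), (29,4)] (above [(0,23), (2,25),
    (11,71), (32,242)])) (value (next 13 [(1,3), (3,3), (29,3), (32,11)] (above [(0,1), (5,2),
    (32,6), (33,4)])) (value (contra [(1,2), (3,3), (27,1), (30,9)]) (above [(1,1), (4,1), (24,1),
    (27,3)]))))) (value (next (-14) [(1,1), (2,1), (9,1), (20,2)] (value (contra [(0,9), (4,6),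
    (27,15), (30,22)]) (value (contra [(0,33), (8,39), (27,72), (30,65)]) (above [(1,1), (5,3),
    (10,2), (28,2)])))) (above [(1,4), (5,5), (7,1), (8,3)])))))) (value (next 6 [(1,1), (20,1),
    (21,5), (23,1)] (above [(0,6), (5,21), (10,9), (22,25)])) (above [(1,3), (9,3), (15,3),
    (17,4)])))))) (above [(1,2), (4,1), (8,1), (9,2)])))) (value (next 1 [(1,1), (10,1), (13,6)]
    (value (next (-2) [(1,2), (3,1), (6,2), (13,1)] (value (next 4 [(1,15), (6,9), (20,6), (22,7)]
    (value (next (-6) [(1,1), (2,1), (9,1), (20,2)] (value (next 9 [(1,9), (2,5), (6,21), (25,17)]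
    (value (contra [(0,7), (9,9), (28,16), (35,9)]) (above [(1,1), (2,1), (8,1), (25,2)]))) (value
    (next 6 [(1,3), (3,3), (25,3), (32,5)] (value (contra [(2,2), (4,3), (28,1), (35,5)]) (value
    (next (-9) [(1,3), (7,1), (9,2), (10,4)] (value (contra [(0,3), (4,4), (13,7), (40,9)]) (value
    (contra [(0,27), (1,8), (33,43), (40,72)]) (above [(1,3), (4,3), (30,3), (37,7)])))) (value
    (contra [(0,1), (3,3), (8,4), (35,3)]) (above [(1,6), (5,7), (8,3), (12,1)]))))) (above
    [(1,1), (25,1), (26,1), (27,1)])))) (value (contra [(0,2), (3,5), (18,7), (26,5)]) (above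
    [(1,3), (2,1), (5,4), (8,3)])))) (value (next 2 [(1,3), (4,6), (20,3), (22,1)] (value (next
    (-3) [(1,1), (6,2), (15,1)] (value (next 5 [(1,1), (6,2), (15,1)] (value (next (-7) [(1,1),
    (7,1), (9,1), (20,2)] (value (contra [(0,1), (4,2), (22,7), (23,3)]) (value (next 8 [(1,1),
    (3,1), (35,1), (42,2)] (value (contra [(0,1), (19,3), (28,4), (45,2)]) (above [(1,1), (2,2),
    (21,3), (42,3)]))) (above [(1,1), (5,2), (16,1)])))) (above [(1,2), (2,1), (8,2), (15,3)])))
    (value (next 3 [(1,3), (30,3), (32,2)] (value (next (-4) [(1,2), (6,3), (31,1)] (value (next 6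
    [(1,2), (6,3), (25,1)] (value (contra [(0,1), (9,2), (18,3), (45,2)]) (above [(1,6), (8,4),
    (15,9), (17,3)]))) (value (next 4 [(1,1), (3,1), (35,1), (42,1)] (value (next (-1) [(0,1),
    (10,2), (47,2)] (above [(1,3), (5,4), (44,1)])) (above [(1,3), (5,3), (8,1)]))) (above [(1,1),
    (35,1), (36,3)])))) (above [(1,2), (5,2), (8,1)]))) (above [(1,2), (4,1), (26,4)])))) (above
    [(1,1), (5,1), (8,1)]))) (above [(1,2), (8,1), (16,2)])))) (above [(1,1), (5,1)]))) (above
    [(0,1), (8,1)])))),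
    next (-3) [(1,2), (3,1), (4,2), (8,1)] (value (next 5 [(1,1), (10,1), (12,1), (13,2)] (value
    (next (-6) [(1,1), (6,2), (11,1), (18,2)] (value (next 6 [(1,1), (3,1), (19,1), (22,2)] (above
    [(0,9), (11,57), (16,39), (22,44)])) (value (contra [(1,1), (3,2), (19,4), (20,2)]) (above
    [(1,8), (4,4), (9,1), (16,40)])))) (value (next (-10) [(1,3), (2,1), (6,4), (9,2)] (value
    (contra [(0,3), (4,5), (6,2), (17,8)]) (value (next 12 [(1,6), (6,9), (19,7), (20,4)] (value
    (next (-1) [(0,8), (6,66), (11,99), (24,49)] (above [(1,4), (5,7), (20,3), (23,6)])) (value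
    (contra [(0,30), (9,39), (22,69), (25,52)]) (value (contra [(0,9), (3,14), (17,35), (22,23)])
    (above [(1,1), (2,1), (8,1), (19,2)]))))) (value (next 9 [(1,3), (3,3), (19,3), (22,8)] (value
    (contra [(2,2), (4,3), (22,1), (25,8)]) (value (contra [(2,27), (4,42), (22,12), (25,112)])
    (value (next (-14) [(1,2), (10,4), (19,5), (21,2)] (value (contra [(0,7), (1,32), (9,71),
    (30,222)]) (value (contra [(0,42), (1,13), (27,68), (30,182)]) (value (contra [(1,33), (3,15),
    (9,51), (30,191)]) (above [(1,3), (4,3), (24,3), (27,11)]))))) (value (contra [(0,12), (3,33),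
    (8,45), (25,50)]) (above [(1,3), (5,4), (8,2), (20,1)])))))) (value (next 8 [(1,3), (3,3),
    (19,3), (22,7)] (above [(0,2), (5,4), (8,1), (22,8)])) (above [(1,3), (5,6), (14,4),
    (15,1)])))))) (value (next (-11) [(1,1), (2,1), (14,2), (18,4)] (value (contra [(0,3), (4,3),
    (17,6), (20,4)]) (value (contra [(0,1), (3,2), (8,8), (17,7)]) (above [(1,1), (5,3), (13,1),
    (14,2)])))) (value (contra [(0,1), (3,3), (8,4), (15,1)]) (above [(1,2), (4,1), (5,2),
    (8,2)])))))) (value (next 4 [(1,15), (6,9), (10,6), (12,7)] (value (next (-6) [(1,3), (2,1),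
    (6,4), (18,5)] (value (next 8 [(1,9), (6,22), (9,2), (11,17)] (value (next (-5) [(0,1), (6,2),
    (27,4), (28,1)] (above [(1,1), (8,1), (24,1), (26,8)])) (value (next (-12) [(1,4), (6,5),
    (7,1), (28,17)] (value (contra [(0,63), (4,39), (23,102), (30,169)]) (value (next 14 [(1,27),
    (3,30), (21,33), (32,121)] (above [(0,1), (5,2), (32,6), (33,3)])) (value (contra [(1,11),
    (3,16), (27,6), (30,48)]) (above [(1,1), (4,1), (24,1), (27,3)]))))) (value (contra [(0,1),
    (3,3), (14,4), (26,17)]) (above [(1,4), (4,1), (5,5), (7,1)]))))) (value (next 5 [(1,3),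
    (3,3), (19,3), (22,5)] (value (contra [(2,1), (4,2), (24,7), (25,1)]) (value (contra [(2,33),
    (4,48), (18,18), (25,86)]) (value (next (-9) [(1,3), (7,1), (9,2), (10,4)] (value (contra
    [(0,3), (4,4), (13,7), (30,9)]) (value (next 10 [(1,39), (3,60), (15,81), (32,212)] (above
    [(0,3), (5,6), (31,3), (32,13)])) (value (contra [(1,3), (3,4), (23,2), (30,10)]) (above
    [(1,3), (5,6), (10,2), (20,1)]))))) (value (contra [(0,1), (3,3), (8,4), (25,3)]) (above
    [(1,6), (5,7), (8,3), (12,1)])))))) (above [(1,1), (15,1), (16,1), (17,1)])))) (value (next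
    (-8) [(1,3), (2,2), (9,3), (10,5)] (value (next 12 [(1,27), (2,11), (6,72), (15,56)] (value
    (contra [(0,4), (9,13), (18,17), (26,39)]) (value (contra [(0,1), (3,2), (7,1), (18,3)])
    (above [(1,1), (2,1), (8,1), (19,2)])))) (value (next 9 [(1,5), (9,1), (10,32), (15,29)]
    (value (next (-1) [(0,21), (6,36), (20,6), (27,86)] (above [(1,1), (8,1), (24,1), (26,9)]))
    (value (next (-13) [(1,2), (6,3), (21,1), (28,6)] (value (contra [(0,12), (4,7), (23,19),
    (30,35)]) (value (contra [(0,105), (1,39), (23,183), (30,481)]) (value (contra [(1,12),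
    (3,17), (23,7), (30,59)]) (above [(1,7), (4,1), (5,10), (24,5)]))))) (value (contra [(0,7),
    (3,6), (18,13), (25,16)]) (above [(1,6), (2,1), (5,7), (14,9)]))))) (above [(1,1), (5,4),
    (10,3), (18,1)])))) (above [(1,2), (4,1), (5,2), (8,1)])))) (value (next 2 [(1,3), (7,2),
    (10,1), (12,1)] (value (next (-3) [(1,3), (2,1), (6,4), (9,1)] (value (next 5 [(1,1), (6,2),
    (15,1)] (value (next (-7) [(1,1), (7,1), (9,1), (20,2)] (value (contra [(0,1), (4,2), (22,7),
    (23,3)]) (value (next 8 [(1,7), (3,8), (21,9), (32,17)] (value (contra [(0,1), (19,3), (28,4),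
    (35,2)]) (above [(1,1), (2,2), (21,3), (32,3)]))) (above [(1,1), (5,2), (16,1)])))) (above
    [(1,2), (2,1), (8,2), (15,3)]))) (value (next 3 [(1,3), (20,3), (22,2)] (value (next (-4)
    [(1,2), (6,3), (22,1)] (value (next 6 [(1,2), (6,3), (25,1)] (value (contra [(0,1), (9,2),
    (18,3), (35,2)]) (above [(1,6), (8,4), (15,9), (17,3)]))) (value (next 4 [(1,1), (3,2),
    (15,3), (32,3)] (value (next (-1) [(0,1), (10,2), (37,2)] (above [(1,3), (5,4), (34,1)]))
    (above [(1,3), (5,3), (8,1)]))) (above [(1,1), (25,1), (26,3)])))) (above [(1,2), (5,2),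
    (8,1)]))) (above [(1,2), (4,1), (16,4)])))) (above [(1,2), (4,1), (5,2)]))) (above [(1,1),
    (2,1), (6,1)])))),
    next (-5) [(1,1), (3,1), (4,1), (8,1)] (value (next 9 [(1,6), (6,15), (9,11), (10,2)] (value
    (contra [(0,2), (9,9), (12,11)]) (value (contra [(0,1), (9,5), (12,6)]) (above [(1,1), (2,1),
    (9,2), (13,2)])))) (value (next 6 [(1,3), (10,3), (12,4)] (value (next (-7) [(1,1), (6,2),
    (11,1), (18,2)] (value (next 8 [(1,3), (3,3), (19,3), (22,7)] (above [(0,1), (5,2), (22,4),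
    (23,3)])) (value (contra [(1,1), (3,2), (19,6), (20,2)]) (above [(1,1), (15,1), (16,6)]))))
    (value (next (-11) [(1,8), (3,2), (6,11), (7,3)] (value (contra [(0,1), (4,5), (9,6), (12,3)])
    (value (next 13 [(1,28), (6,68), (11,49), (20,9)] (value (next (-3) [(0,69), (6,120), (24,18),
    (27,400)] (above [(1,1), (5,3), (10,3), (15,1)])) (value (contra [(0,13), (9,14), (22,27),
    (25,28)]) (value (contra [(0,2), (3,3), (11,3), (22,5)]) (above [(1,1), (2,1), (8,1),
    (19,2)]))))) (value (next 11 [(1,154), (3,37), (6,198), (19,118)] (value (contra [(2,2),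
    (4,3), (22,1), (25,9)]) (value (next (-6) [(0,15), (2,9), (10,39), (27,127)] (above [(1,1),
    (8,1), (21,6), (24,7)])) (value (contra [(0,27), (3,78), (8,105), (25,128)]) (above [(1,3),
    (5,5), (8,1), (10,2)]))))) (value (next 9 [(1,3), (3,3), (19,3), (22,8)] (above [(0,3), (5,6),
    (14,2), (22,14)])) (above [(1,12), (5,21), (14,14), (15,5)])))))) (value (next (-12) [(1,1),
    (2,1), (14,2), (18,6)] (value (contra [(0,1), (8,3), (17,4), (21,6)]) (value (contra [(0,18),
    (8,33), (17,51), (20,22)]) (above [(1,1), (5,3), (10,2)])))) (value (contra [(0,2), (3,3),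
    (12,5), (15,2)]) (above [(1,2), (4,1), (5,2), (8,2)])))))) (value (next 5 [(1,6), (7,1),
    (10,5), (12,6)] (value (next (-7) [(1,4), (2,1), (6,5), (9,2)] (value (next 9 [(1,2), (6,4),
    (15,3), (17,1)] (value (next (-1) [(0,5), (6,8), (20,2), (27,20)] (above [(1,1), (8,1),
    (24,1), (26,9)])) (value (next (-5) [(0,45), (2,69), (16,159), (27,389)] (above [(1,2), (5,5),
    (10,3), (28,1)])) (above [(1,1), (2,1), (11,2), (22,2)])))) (value (next 7 [(1,18), (3,21),
    (15,24), (22,52)] (value (contra [(2,2), (4,1), (8,3), (25,7)]) (value (next (-4) [(0,2),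
    (2,1), (10,5), (27,11)] (above [(1,6), (5,8), (8,1), (24,4)])) (above [(1,15), (5,24), (17,9),
    (22,10)])))) (value (contra [(1,2), (3,3), (17,1), (20,5)]) (above [(1,2), (4,1),
    (16,10)]))))) (value (next (-9) [(1,2), (2,1), (9,2), (10,3)] (value (contra [(0,27), (4,33),
    (13,60), (20,55)]) (value (next 11 [(1,1), (10,6), (15,5), (23,1)] (value (contra [(0,2),
    (2,1), (18,4), (25,10)]) (value (contra [(0,24), (3,69), (8,93), (25,98)]) (above [(1,3),
    (4,1), (5,4), (20,1)])))) (above [(1,1), (5,4), (10,3), (18,3)])))) (above [(1,2), (4,1),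
    (5,2), (8,1)])))) (above [(1,1), (2,1), (6,2)]))))]

open SearchTree in
/-- The search trees for a term `a₀ ≤ -6` of maximal modulus and `s₀ = 0, -1, -2`. -/
def searchTreesLargeNeg : List SearchTree := [
    next 1 [(1,1), (5,1), (8,6)] (value (next (-2) [(1,2), (3,1), (6,2), (8,1)] (value (next 4
    [(1,15), (6,9), (15,6), (17,7)] (value (next (-6) [(1,3), (2,1), (6,4), (23,5)] (value (next 9
    [(1,9), (2,5), (6,21), (21,17)] (value (contra [(0,7), (9,9), (24,16), (30,9)]) (above [(1,1),
    (2,1), (8,1), (21,2)]))) (value (next 6 [(1,3), (3,3), (21,3), (27,5)] (value (contra [(2,2),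
    (4,3), (24,1), (30,5)]) (value (next (-9) [(1,3), (7,1), (9,2), (10,4)] (value (contra [(0,3),
    (4,4), (13,7), (35,9)]) (value (contra [(0,27), (1,8), (29,43), (35,72)]) (above [(1,3),
    (4,3), (26,3), (32,7)])))) (value (contra [(0,1), (3,3), (8,4), (30,3)]) (above [(1,6), (5,7),
    (8,3), (12,1)]))))) (above [(1,1), (20,1), (21,1), (22,1)])))) (value (contra [(0,2), (3,5),
    (14,7), (21,5)]) (above [(1,3), (2,1), (5,4), (8,3)])))) (value (next 2 [(1,3), (4,6), (15,3),
    (17,1)] (value (next (-3) [(1,1), (6,2), (15,1)] (value (next 5 [(1,1), (6,2), (15,1)] (value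
    (next (-7) [(1,1), (7,1), (9,1), (20,2)] (value (contra [(0,1), (4,2), (22,7), (23,3)]) (value
    (next 8 [(1,7), (3,8), (21,9), (37,17)] (value (contra [(0,1), (19,3), (28,4), (40,2)]) (above
    [(1,1), (2,2), (21,3), (37,3)]))) (above [(1,1), (5,2), (16,1)])))) (above [(1,2), (2,1),
    (8,2), (15,3)]))) (value (next 3 [(1,3), (25,3), (27,2)] (value (next (-4) [(1,2), (6,3),
    (25,1)] (value (next 6 [(1,2), (6,3), (25,1)] (value (contra [(0,1), (9,2), (18,3), (40,2)])
    (above [(1,6), (8,4), (15,9), (17,3)]))) (value (next 4 [(1,1), (3,2), (15,3), (37,3)] (value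
    (next (-1) [(0,1), (10,2), (42,2)] (above [(1,3), (5,4), (39,1)])) (above [(1,3), (5,3),
    (8,1)]))) (above [(1,1), (30,1), (31,3)])))) (above [(1,2), (5,2), (8,1)]))) (above [(1,2),
    (4,1), (21,4)])))) (above [(1,1), (5,1), (8,1)]))) (above [(1,1), (5,1), (11,1)])))) (value
    (next (-5) [(1,2), (3,1), (8,2), (9,2)] (value (next 9 [(1,6), (6,15), (14,11), (15,2)] (value
    (contra [(0,2), (9,9), (17,11)]) (value (contra [(0,1), (9,5), (17,6)]) (above [(1,1), (2,1),
    (8,1), (14,2)])))) (value (next 6 [(1,3), (15,3), (17,4)] (value (next (-7) [(1,1), (6,2),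
    (11,1), (23,2)] (value (next 8 [(1,3), (3,3), (24,3), (27,7)] (above [(0,1), (5,2), (27,4),
    (28,3)])) (value (contra [(1,1), (3,2), (24,6), (25,2)]) (above [(1,1), (20,1), (21,6)]))))
    (value (next (-11) [(1,8), (3,2), (6,11), (7,3)] (value (contra [(0,1), (4,5), (9,6), (16,9)])
    (value (next 13 [(1,28), (6,68), (11,49), (25,9)] (value (next (-3) [(0,69), (6,120), (29,18),
    (32,400)] (above [(1,2), (5,4), (16,3), (22,1)])) (value (contra [(0,13), (9,14), (27,27),
    (30,28)]) (value (contra [(0,2), (3,3), (11,3), (27,5)]) (above [(1,1), (2,1), (8,1),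
    (24,2)]))))) (value (next 11 [(1,154), (3,37), (6,198), (24,118)] (value (contra [(2,2),
    (4,3), (27,1), (30,9)]) (value (next (-6) [(0,15), (2,9), (10,39), (32,127)] (above [(1,1),
    (8,1), (21,6), (29,7)])) (value (contra [(0,27), (3,78), (8,105), (30,128)]) (above [(1,7),
    (5,9), (8,3), (19,1)]))))) (value (next 9 [(1,3), (3,3), (24,3), (27,8)] (above [(0,3), (5,6),
    (18,6), (27,14)])) (above [(1,12), (5,21), (19,14), (20,5)])))))) (value (next (-12) [(1,1),
    (2,1), (19,2), (23,6)] (value (contra [(0,1), (8,3), (22,4), (26,6)]) (value (contra [(0,18),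
    (8,33), (22,51), (25,22)]) (above [(1,1), (5,3), (10,2)])))) (value (contra [(0,2), (3,3),
    (17,5), (20,2)]) (above [(1,2), (5,3), (7,1), (8,2)])))))) (value (next 5 [(1,1), (15,1),
    (17,1), (18,1)] (value (next (-7) [(1,4), (2,1), (6,5), (9,2)] (value (next 9 [(1,2), (6,4),
    (15,3), (20,1)] (value (next (-1) [(0,5), (6,8), (20,2), (32,20)] (above [(1,1), (8,1),
    (29,1), (31,9)])) (value (next (-5) [(0,45), (2,69), (16,159), (32,389)] (above [(1,2), (5,5),
    (10,3), (33,1)])) (above [(1,1), (2,1), (11,2), (27,2)])))) (value (next 7 [(1,18), (3,21),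
    (15,24), (27,52)] (value (contra [(2,2), (4,1), (8,3), (30,7)]) (value (next (-4) [(0,2),
    (2,1), (10,5), (32,11)] (above [(1,6), (5,8), (8,1), (29,4)])) (above [(1,15), (5,24), (20,9),
    (27,10)])))) (value (contra [(1,2), (3,3), (22,1), (25,5)]) (above [(1,2), (4,1),
    (21,10)]))))) (value (next (-9) [(1,2), (2,1), (9,2), (10,3)] (value (contra [(0,27), (4,33),
    (13,60), (25,55)]) (value (next 11 [(1,1), (10,6), (15,5), (28,1)] (value (contra [(0,2),
    (2,1), (18,4), (30,10)]) (value (contra [(0,24), (3,69), (8,93), (30,98)]) (above [(1,3),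
    (4,1), (5,4), (25,1)])))) (above [(1,1), (5,4), (10,3), (23,3)])))) (above [(1,4), (5,6),
    (8,5), (9,1)])))) (above [(1,1), (5,1), (11,2)]))))) (above [(1,1), (4,1)]))),
    next 2 [(1,1), (5,1), (6,1), (8,6)] (value (next (-3) [(1,2), (3,1), (6,2), (8,1)] (value
    (next 4 [(1,1), (15,1), (17,1)] (value (next (-2) [(0,1), (6,2), (22,2), (23,1)] (above
    [(1,1), (20,1), (21,4)])) (value (next (-7) [(1,3), (6,4), (7,1), (23,6)] (value (contra
    [(0,5), (4,4), (19,9), (25,8)]) (value (next 8 [(1,45), (3,48), (21,51), (27,107)] (value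
    (contra [(0,5), (6,3), (24,11), (30,17)]) (above [(1,21), (2,48), (21,69), (27,77)]))) (above
    [(1,1), (5,2), (16,1)])))) (above [(1,2), (2,1), (8,2), (11,3)])))) (value (next 3 [(1,9),
    (9,1), (15,7), (17,6)] (value (next (-4) [(1,4), (6,5), (7,1), (9,1)] (value (next 6 [(1,1),
    (6,2), (15,1), (28,1)] (value (contra [(0,1), (3,1), (18,2), (30,2)]) (above [(1,4), (8,5),
    (9,2), (15,8)]))) (value (next 4 [(1,3), (21,3), (25,6), (27,4)] (value (next 0 [(0,1),
    (10,2), (32,2)] (above [(1,1), (8,1), (29,1), (31,4)])) (above [(1,8), (5,8), (8,3)]))) (above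
    [(1,3), (6,6), (20,9), (22,7)])))) (above [(1,3), (5,3), (8,2)]))) (above [(1,3), (4,1),
    (7,1), (11,6)])))) (value (next (-6) [(1,2), (3,1), (6,2), (8,2)] (value (contra [(0,2),
    (4,7), (9,9), (16,7)]) (value (next 7 [(1,5), (3,1), (6,11), (11,8)] (value (next (-7)
    [(0,15), (6,48), (11,18), (22,62)] (value (contra [(1,1), (3,4), (14,13), (19,11)]) (above
    [(1,3), (4,3), (19,3), (22,7)]))) (value (next (-11) [(1,13), (2,3), (6,16), (23,53)] (value
    (next 15 [(1,108), (2,29), (6,204), (21,125)] (above [(0,12), (2,41), (21,65), (27,172)]))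
    (value (next 12 [(1,3), (3,3), (24,3), (27,10)] (value (contra [(2,6), (4,3), (8,9), (30,34)])
    (value (contra [(0,39), (3,21), (24,60), (30,119)]) (above [(1,27), (2,10), (5,37),
    (27,42)])))) (value (contra [(1,6), (3,9), (19,3), (25,25)]) (above [(1,44), (5,81), (8,8),
    (16,53)]))))) (value (next (-13) [(1,5), (2,4), (9,5), (16,9)] (value (contra [(0,2), (8,7),
    (16,7), (19,9)]) (value (contra [(0,9), (8,12), (22,21), (25,16)]) (above [(1,5), (5,9),
    (8,1), (19,6)])))) (above [(1,3), (2,2), (8,3), (11,5)]))))) (value (next 5 [(1,3), (5,3),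
    (15,6), (17,7)] (value (next 0 [(0,2), (6,3), (10,1), (22,5)] (above [(1,4), (5,6), (8,1),
    (16,4)])) (value (next (-8) [(1,5), (2,1), (6,6), (9,2)] (value (next 10 [(1,4), (6,7), (7,1),
    (21,4)] (value (contra [(2,9), (4,12), (18,6), (30,38)]) (value (contra [(0,6), (9,9),
    (18,15), (30,19)]) (above [(1,1), (7,1), (11,2), (27,2)])))) (value (next 8 [(1,3), (3,3),
    (24,3), (27,7)] (above [(0,1), (5,2), (27,4), (28,1)])) (value (contra [(1,5), (3,6), (13,4),
    (25,16)]) (above [(1,1), (4,1), (19,1), (22,2)]))))) (value (next (-9) [(1,1), (2,1), (10,2),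
    (22,2)] (value (next 12 [(1,1), (10,6), (15,5), (28,4)] (above [(0,13), (2,28), (15,54),
    (27,138)])) (above [(1,1), (5,2), (16,1)]))) (above [(1,6), (5,8), (8,5), (9,1)]))))) (above
    [(1,3), (7,1), (10,2), (12,3)]))))) (value (next (-8) [(1,1), (2,1), (9,2), (13,1)] (value
    (contra [(0,1), (4,2), (12,3), (16,2)]) (value (next 10 [(1,48), (3,13), (6,84), (14,62)]
    (value (contra [(0,13), (4,10), (9,50), (17,53)]) (value (next (-15) [(1,1), (2,1), (19,2),
    (23,12)] (value (contra [(0,1), (14,3), (22,4), (25,1)]) (value (contra [(0,2), (14,7),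
    (22,9), (26,7)]) (above [(1,92), (4,37), (11,253), (19,235)])))) (value (contra [(0,1), (9,3),
    (17,4), (21,3)]) (above [(1,1), (2,1), (8,1), (14,2)]))))) (value (next 7 [(1,9), (3,4),
    (6,1), (16,50)] (value (contra [(2,3), (4,6), (19,12), (20,8)]) (value (next (-3) [(0,1),
    (6,2), (22,4), (23,1)] (above [(1,1), (8,1), (19,1), (21,8)])) (value (next (-12) [(1,5),
    (2,1), (6,6), (13,5)] (value (next 15 [(1,6), (3,1), (6,8), (24,4)] (above [(0,23), (2,25),
    (11,71), (27,242)])) (value (next 13 [(1,3), (3,3), (24,3), (27,11)] (above [(0,1), (5,2),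
    (27,6), (28,4)])) (value (contra [(1,2), (3,3), (22,1), (25,9)]) (above [(1,1), (4,1), (19,1),
    (22,3)]))))) (value (next (-14) [(1,1), (10,3), (15,2), (23,8)] (value (contra [(0,9), (4,6),
    (22,15), (25,22)]) (value (contra [(0,33), (8,39), (22,72), (25,65)]) (above [(1,1), (5,3),
    (10,2), (23,2)])))) (above [(1,4), (5,5), (7,1), (8,3)])))))) (value (next 6 [(1,1), (15,1),
    (16,5), (18,1)] (above [(0,6), (5,21), (10,9), (17,25)])) (above [(1,6), (7,1), (10,5),
    (12,8)])))))) (above [(1,2), (3,1), (4,2), (8,1)])))),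
    next 4 [(1,3), (2,2), (5,1), (7,2)] (value (next (-6) [(1,1), (6,2), (7,1), (13,2)] (value
    (next 8 [(1,4), (6,9), (11,6), (15,1)] (value (next (-4) [(0,1), (6,2), (22,4), (23,1)] (above
    [(1,3), (5,4), (8,1), (19,3)])) (value (next (-12) [(1,5), (2,1), (6,6), (9,2)] (value (contra
    [(0,19), (4,14), (19,33), (25,56)]) (value (contra [(0,84), (1,39), (19,162), (25,416)])
    (value (contra [(1,21), (3,31), (22,11), (25,93)]) (above [(1,4), (5,6), (8,1), (19,4)])))))
    (value (contra [(0,2), (3,6), (7,3), (14,8)]) (above [(1,5), (2,1), (5,6), (8,3)]))))) (value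
    (next 5 [(1,1), (15,1), (16,5)] (value (contra [(2,3), (4,4), (14,2), (20,8)]) (value (contra
    [(2,1), (4,1), (8,1), (20,3)]) (value (next (-9) [(1,5), (6,7), (8,1), (13,4)] (value (contra
    [(0,1), (1,1), (13,3), (25,7)]) (value (next 10 [(1,7), (3,10), (15,13), (27,36)] (above
    [(0,3), (5,6), (27,14)])) (value (contra [(1,21), (3,9), (9,33), (25,76)]) (above [(1,2),
    (5,4), (10,1), (16,1)]))))) (value (contra [(0,15), (3,42), (8,57), (20,46)]) (above [(1,8),
    (5,9), (7,1), (8,5)])))))) (above [(1,3), (10,3), (12,4)])))) (value (next (-9) [(1,1), (2,1),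
    (9,2), (13,2)] (value (contra [(0,7), (4,9), (12,16), (15,6)]) (value (next 11 [(1,30),
    (6,48), (14,37), (15,19)] (value (contra [(2,19), (4,130), (9,208), (17,116)]) (value (next
    (-15) [(1,4), (2,9), (19,13), (22,20)] (value (contra [(0,3), (8,3), (22,6), (25,7)]) (above
    [(1,8), (2,17), (11,60), (19,69)]))) (value (contra [(0,8), (3,13), (17,21), (21,91)]) (above
    [(1,1), (2,1), (8,1), (14,2)]))))) (value (next 8 [(1,3), (3,3), (14,3), (17,7)] (value
    (contra [(2,3), (4,6), (19,18), (20,8)]) (value (next (-1) [(0,42), (6,75), (19,9), (22,175)]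
    (above [(1,3), (5,6), (7,1), (16,4)])) (value (next (-13) [(1,5), (6,8), (9,1), (15,3)] (value
    (contra [(0,72), (4,39), (22,111), (25,182)]) (value (next 14 [(1,5), (3,1), (6,6), (24,3)]
    (above [(0,3), (5,6), (27,20), (28,6)])) (value (contra [(1,30), (3,21), (9,39), (25,161)])
    (above [(1,3), (4,3), (19,3), (22,10)]))))) (value (next (-14) [(1,3), (2,3), (10,6), (22,10)]
    (value (contra [(0,3), (8,3), (22,6), (25,7)]) (above [(1,1), (5,3), (10,2), (23,3)]))) (above
    [(1,6), (2,1), (5,7), (8,4)])))))) (value (next 6 [(1,1), (3,1), (14,1), (17,2)] (above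
    [(0,3), (5,9), (10,3), (17,13)])) (above [(1,3), (10,3), (11,3), (12,4)])))))) (value (contra
    [(0,1), (3,3), (7,4)]) (above [(1,1), (3,1), (4,1), (8,1)]))))]

/-- The searches for the maximal moduli `M ≤ 5`. The entries of the list are the sign of the maximal
term, `M`, and the search trees. -/
lemma check_small : ∀ q ∈ [((1 : ℤ), (1 : ℤ), searchTreesOnePos), (-1, 1, searchTreesOneNeg),
    (1, 2, searchTreesTwoPos), (-1, 2, searchTreesTwoNeg), (1, 3, searchTreesThreePos),
    (-1, 3, searchTreesThreeNeg), (1, 4, searchTreesFourPos), (-1, 4, searchTreesFourNeg),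
    (1, 5, searchTreesFivePos), (-1, 5, searchTreesFiveNeg)],
    checkList ⟨0, 0, q.2.1, 0⟩ ⟨0, 0, q.1 * q.2.1, 0⟩ smallConstraints q.1 0 q.2.2 = true ∧
      (q.2.2.length : ℤ) = 2 * q.2.1 + 1 := by
  decide +kernel

/-- The searches for maximal moduli of at least `6`, for both signs of the maximal term. -/
lemma check_large : ∀ q ∈ [((1 : ℤ), searchTreesLargePos), (-1, searchTreesLargeNeg)],
    checkList ⟨0, 0, 0, 1⟩ ⟨0, 0, 0, q.1⟩ largeConstraints q.1 0 q.2 = true ∧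
      (q.2.length : ℤ) = 3 := by
  decide +kernel

lemma exists_check_small {τ M : ℤ} (hτ : τ = 1 ∨ τ = -1) (h1 : 1 ≤ M) (h5 : M ≤ 5) :
    ∃ l, checkList ⟨0, 0, M, 0⟩ ⟨0, 0, τ * M, 0⟩ smallConstraints τ 0 l = true ∧
      (l.length : ℤ) = 2 * M + 1 := by
  have H := check_small
  simp only [List.forall_mem_cons] at H
  obtain ⟨h1p, h1n, h2p, h2n, h3p, h3n, h4p, h4n, h5p, h5n, -⟩ := H
  rcases hτ with rfl | rfl <;> interval_cases M
  exacts [⟨_, h1p⟩, ⟨_, h2p⟩, ⟨_, h3p⟩, ⟨_, h4p⟩, ⟨_, h5p⟩, ⟨_, h1n⟩, ⟨_, h2n⟩, ⟨_, h3n⟩, ⟨_, h4n⟩,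
    ⟨_, h5n⟩]

lemma exists_check_large {τ : ℤ} (hτ : τ = 1 ∨ τ = -1) :
    ∃ l, checkList ⟨0, 0, 0, 1⟩ ⟨0, 0, 0, τ⟩ largeConstraints τ 0 l = true ∧
      (l.length : ℤ) = 3 := by
  have H := check_large
  simp only [List.forall_mem_cons] at H
  obtain ⟨hp, hn, -⟩ := H
  rcases hτ with rfl | rfl
  exacts [⟨_, hp⟩, ⟨_, hn⟩]

namespace IsCycle

variable {x y : ℝ} {p : ℕ} {a : ℕ → ℤ}

/-- The pentagon of parameters that is settled by the search, starting at a term of maximal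
modulus. -/
lemma eq_zero_of_search (h : IsCycle x y p a) (hx : 4 / 3 ≤ x) (h0 : 0 ≤ x + y)
    (h5 : x + y < 5) (h5' : x - y < 5) (hd : y < x + 1) (n : ℕ) : a n = 0 := by
  refine h.eq_zero_of_max (fun N hN hne => ?_) n
  have hδ : 0 < 1 + x - y := by linarith
  -- `τ` is the sign of the maximal term, and `τ * i` is its sum with its successor
  obtain ⟨τ, hτ, hτM⟩ : ∃ τ : ℤ, (τ = 1 ∨ τ = -1) ∧ a (N + 1) = τ * |a (N + 1)| := by
    rcases lt_or_gt_of_ne hne with h | h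
    · exact ⟨-1, Or.inr rfl, by rw [abs_of_neg h]; ring⟩
    · exact ⟨1, Or.inl rfl, by rw [abs_of_pos h]; ring⟩
  set M := |a (N + 1)| with hM
  have hM1 : 1 ≤ M := Int.one_le_abs hne
  have hMR : (1 : ℝ) ≤ M := by exact_mod_cast hM1
  have hbd (n : ℕ) : |(1 + x - y) * a n| ≤ (1 + x - y) * M := by
    rw [abs_mul, abs_of_pos hδ]
    exact mul_le_mul_of_nonneg_left (by exact_mod_cast hN n) hδ.le
  have hnext := abs_le.1 (hN (N + 2))
  have hprev := abs_le.1 (hN N)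
  obtain ⟨i, hi⟩ : ∃ i, a (N + 1) + a (N + 2) = τ * i :=
    ⟨τ * (a (N + 1) + a (N + 2)), by rcases hτ with rfl | rfl <;> ring⟩
  have hi0 : 0 ≤ i := by rcases hτ with rfl | rfl <;> omega
  have hi2 : i ≤ 2 * M := by rcases hτ with rfl | rfl <;> omega
  have hMτ : (a (N + 1) : ℝ) = τ * M := by exact_mod_cast hτM
  rcases le_or_gt M 5 with hM5 | hM5
  · obtain ⟨l, hl, hlen⟩ := exists_check_small hτ hM1 hM5
    refine h.false_of_checkList (e := 0) hδ (fun n => ?_) hl (n := N + 1) hi0 (by omega) hi ?_ ?_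
    · simpa [mul_comm] using hbd n
    · rw [hMτ]
      simp [mul_comm]
    · simp only [smallConstraints, List.forall_mem_cons, Constraint.Holds, AffineForm.eval_mk]
      norm_num
      refine ⟨?_, ⟨?_, ?_⟩, ⟨?_, ?_⟩, ?_, ?_, ?_⟩ <;> linarith
  · obtain ⟨hy2, hE⟩ := h.two_le_and_mul_le hx h0 h5 h5' hd (N := N + 1) (by omega)
    rw [← Int.cast_abs, ← hM] at hE
    have hM6 : (6 : ℝ) ≤ M := by exact_mod_cast (by omega : 6 ≤ M)
    -- the preceding sum has the sign `τ` as well, so the rounding error limits the size of `i`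
    have hiE : (i : ℝ) < 1 + (1 + x - y) * M := by
      have hl := h.nonneg N
      have hu := h.lt_one N
      have hiR : (a (N + 1) : ℝ) + a (N + 2) = τ * i := by exact_mod_cast hi
      have hs : 0 ≤ (τ : ℝ) * (a N + a (N + 1)) := by
        exact_mod_cast (by rcases hτ with rfl | rfl <;> omega : 0 ≤ τ * (a N + a (N + 1)))
      have hxs : 0 ≤ x * (τ * (a N + a (N + 1))) := mul_nonneg (by linarith) hs
      rw [hMτ] at hxs hiR hl hu
      rcases hτ with rfl | rfl <;> push_cast at hxs hiR hl hu <;> linarith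
    have hi3 : i < 3 := by exact_mod_cast (by linarith : (i : ℝ) < 3)
    obtain ⟨l, hl, hlen⟩ := exists_check_large hτ
    refine h.false_of_checkList (e := (1 + x - y) * M) hδ (fun n => ?_) hl (n := N + 1) hi0
      (by omega) hi ?_ ?_
    · simpa using hbd n
    · rw [hMτ]
      simp
      ring
    · have h6 : 6 * (1 + x - y) ≤ (1 + x - y) * M := by
        rw [mul_comm]
        exact mul_le_mul_of_nonneg_left hM6 hδ.le
      simp only [largeConstraints, List.forall_mem_cons, Constraint.Holds, AffineForm.eval_mk]
      norm_num
      refine ⟨?_, ⟨?_, ?_⟩, ?_, ?_, ?_, ?_, ?_, ?_⟩ <;> linarith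

end IsCycle

/-! ### Conclusion -/

/-- Parameters without obvious cycles are in `𝒟₂^(*)`, except possibly in the part
`0 ≤ r₀ < 4 / 3` of the sector `-r₀ ≤ r₁ < r₀ + 1`. -/
lemma mem_DStar_of_notMem_obviousCycles {r : ℝ × ℝ} (hO : r ∉ obviousCycles)
    (hr : ¬ (0 ≤ r.1 ∧ r.1 < 4 / 3 ∧ -r.1 ≤ r.2 ∧ r.2 < r.1 + 1)) : r ∈ DStar := by
  obtain ⟨x, y⟩ := r
  simp only [obviousCycles, Set.mem_union, Set.mem_ofPred_eq, not_or, not_and, not_lt,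
    not_le] at hO hr
  obtain ⟨⟨⟨hO1, hO2⟩, hO3⟩, hO4⟩ := hO
  refine mem_DStar_of_forall fun p a h => ?_
  simp only at h
  rcases lt_or_ge (x + y) 0 with hxy | hxy
  · have h2 : x + y ≤ -2 := by
      by_contra hcon
      push Not at hcon
      exact absurd (hO1 hcon) (by linarith)
    exact h.eq_zero_of_add_le h2 hO2 fun h3 =>
      absurd (hO3 ⟨h3.1, by linarith [h3.2]⟩ h3.2) (by linarith [h3.1])
  rcases lt_or_ge x 0 with hx | hx
  · refine h.eq_zero_of_neg_fst hx ?_ hxy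
    by_contra hcon
    push Not at hcon
    exact absurd (hO4 ⟨by linarith, hx⟩ (by linarith)) (by linarith)
  rcases lt_or_gt_of_ne hO2 with hd | hd
  · have hx43 : 4 / 3 ≤ x := by
      by_contra hcon
      push Not at hcon
      exact absurd (hr hx hcon (by linarith)) (by linarith)
    rcases le_or_gt 5 (x + y) with h5 | h5
    · exact h.eq_zero_of_five_le_add h5 hO2
    rcases le_or_gt 5 (x - y) with h5' | h5'
    · exact h.eq_zero_of_five_le_sub h5' hxy
    exact h.eq_zero_of_search hx43 hxy h5 h5' hd
  · exact h.eq_zero_of_lt_snd hx hd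

end SRS

theorem mainTheorem1 :
    Bornology.IsBounded SRS.unsettled ∧
    (∀ r : ℝ × ℝ, r ∈ SRS.unsettled → 4 / 3 ≤ r.1 → r ∈ SRS.DStar) ∧
    (∀ r : ℝ × ℝ, r ∉ SRS.schurCohn → r ∉ SRS.remaining →
      (r ∈ SRS.DStar ↔ r ∉ SRS.obviousCycles)) := by
  refine ⟨SRS.isBounded_unsettled, fun r hr h43 => ?_, fun r hE hR =>
    ⟨SRS.notMem_obviousCycles_of_mem_DStar, fun hO => ?_⟩⟩
  · refine SRS.mem_DStar_of_notMem_obviousCycles (fun hO => hr ?_) fun h => ?_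
    · exact Or.inl (Or.inl (Or.inl (Or.inl hO)))
    · linarith [h.2.1]
  · refine SRS.mem_DStar_of_notMem_obviousCycles hO fun h => ?_
    rcases lt_or_ge r.1 1 with h1 | h1
    · exact hE (SRS.mem_schurCohn h.1 h1 h.2.2.1 h.2.2.2)
    · exact hR ⟨⟨h1, h.2.1⟩, h.2.2⟩
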